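/- A \emph{linking pairing} on a finite abelian group $G$ is a symmetric bilinear form $\lambda: G\times G\to\mathbb{Q}/\mathbb{Z}$ whose adjoint homomorphism $G\to\mathrm{Hom}(G,\mathbb{Q}/\mathbb{Z})$ is bijective. If $G$ is a finite abelian $2$-group, then $(G,\lambda)$ has an orthogonal decomposition $\bigoplus_{k\ge 1}(G_k,\lambda_k)$ with $G_k$ a free $\mathbb{Z}/2^k\mathbb{Z}$-module; for $k\geq 1$ let $\rho_k(\lambda)\in\mathbb{N}$ be the rank of $G_k$ (it does not depend on the decomposition), and let $$\Gamma_k(\lambda)=\sum_{x\in G}\exp\bigl(\sqrt{-1}\,\pi\,2^k\lambda(x,x)\bigr).$$ If $\Gamma_k(\lambda)\neq 0$, then $\Gamma_k(\lambda)/|\Gamma_k(\lambda)|$ is an $8$th root of unity. Put $\overline{\mathbb{Z}}_8=\mathbb{Z}/8\mathbb{Z}\cup\{\infty\}$, with $\infty$ absorbing for addition, and let $\sigma_k(\lambda)\in\overline{\mathbb{Z}}_8$ be $\infty$ if $\Gamma_k(\lambda)=0$, and otherwise the element $j\in\mathbb{Z}/8\mathbb{Z}$ with $\Gamma_k(\lambda)/|\Gamma_k(\lambda)|=\exp(2\pi\sqrt{-1}\,j/8)$.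 Let $\mathbb{N}^\times=\{1,2,3,\dots\}$ and let $T:\mathbb{N}^\times\to\mathbb{N}\times\overline{\mathbb{Z}}_8$, $m\mapsto(r(m),s(m))$, be a finite tableau, that is, $T(m)=(0,0)$ for all but finitely many $m$. Call $T$ \emph{admissible} if there is a linking pairing $\lambda$ on a finite abelian $2$-group with $r(m)=\rho_m(\lambda)$ and $s(m)=\sigma_m(\lambda)$ for all $m\geq 1$. Call $m\in\mathbb{N}^\times$ \emph{regular} if $r(m)=0$ or $s(m)\neq\infty$. A congruence for, or a condition on a difference of, elements of $\overline{\mathbb{Z}}_8$ includes the assertion that these elements are different from $\infty$. \textbf{Theorem.} A finite tableau $T$ is admissible if and only if the following four conditions hold. \begin{enumerate} \item[(1)] $r(m)$ is even for every regular $m$. \item[(2)] $s(m)\equiv\sum_{k\geq m+1}r(k)\pmod 2$ for every regular $m$. \item[(3)] $s(m)+s(m+1)\equiv 2\sum_{k\geq m+2}r(k)\pmod 4$ whenever $m$ and $m+1$ are both regular. \item[(4)] Let $I\subset\mathbb{N}^\times$ be a non-empty finite set of consecutive integers such that its delimiters $m=\min I-1$ and $n=\max I+1$ both lie in $\mathbb{N}^\times$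 and are regular. Then \begin{itemize} \item (type $T_0$) if $|I|$ is odd and $r(i)=0$ for all $i\in I$, then $s(m)-s(n)=0$; \item (type $T_1$) if $I=\{i\}$ and $(r(i),s(i))=(1,\infty)$, then $s(m)-s(n)\in\{1,-1\}$; \item (type $T_2$) if $I=\{i\}$ and $(r(i),s(i))=(2,\infty)$, then $s(m)-s(n)\in\{0,2,-2\}$; \item (type $T_3$) if $|I|$ is odd and every $i\in I$ is regular, then $s(m)-s(n)\in\{0,4\}$. \end{itemize} \end{enumerate} -/

import Mathlib

namespace Enlacement

noncomputable section

/-! ### Linking pairings and their invariants -/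

/-- The group `ℚ/ℤ`. -/
abbrev QmodZ : Type := AddCircle (1 : ℚ)

/-- A linking pairing on an abelian group `G` (used for finite `G`): a symmetric bilinear form
`G × G → ℚ/ℤ` whose adjoint homomorphism `G → Hom(G, ℚ/ℤ)` is bijective. -/
structure LinkingPairing (G : Type*) [AddCommGroup G] where
  /-- the adjoint homomorphism, i.e. the pairing itself in curried form -/
  form : G →+ G →+ QmodZ
  symm : ∀ x y : G, form x y = form y x
  bijective_adjoint : Function.Bijective form

/-- The monoid `ℤ/8 ∪ {∞}`; `∞ = ⊤` is absorbing for addition. -/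
abbrev Z8bar : Type := WithTop (ZMod 8)

/-- For `k ≥ 1` the function `q ↦ exp(√-1 π 2^k q)` is `1`-periodic on `ℚ`. -/
theorem periodic_exp (k : ℕ+) :
    Function.Periodic
      (fun q : ℚ => Complex.exp (Complex.I * Real.pi * 2 ^ (k : ℕ) * (q : ℂ))) 1 := by
  intro q
  obtain ⟨j, hj⟩ : ∃ j : ℕ, (k : ℕ) = j + 1 := ⟨k.natPred, (PNat.natPred_add_one k).symm⟩
  have h : Complex.I * Real.pi * 2 ^ (k : ℕ) * ((q + 1 : ℚ) : ℂ)
      = Complex.I * Real.pi * 2 ^ (k : ℕ) * (q : ℂ)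
        + ((2 ^ j : ℕ) : ℂ) * (2 * Real.pi * Complex.I) := by
    rw [hj]; push_cast; ring
  simp only [h]
  exact Complex.exp_periodic.nat_mul (2 ^ j) _

/-- `t ↦ exp(√-1 π 2^k t)` as a function on `ℚ/ℤ`, for `k ≥ 1`. -/
def phase (k : ℕ+) : QmodZ → ℂ := (periodic_exp k).lift

section Invariants

variable {G : Type*} [AddCommGroup G]

/-- The Gauss sum `Γ_k(G, λ) = ∑_{x ∈ G} exp(√-1 π 2^k λ(x, x))`. -/
def gaussSum [Fintype G] (l : LinkingPairing G) (k : ℕ+) : ℂ :=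
  ∑ x : G, phase k (l.form x x)

open Classical in
/-- The invariant `σ_k(λ) ∈ ℤ/8 ∪ {∞}`. It is `∞` if `Γ_k = 0`. Otherwise it is the unique
`j ∈ ℤ/8` with `Γ_k / |Γ_k| = exp(2π√-1 j / 8)`, that is, the argument of `Γ_k`, counted in
multiples of `2π / 8`; `ZMod.stdAddChar j` is `exp(2π√-1 j / 8)`. -/
def sigma [Fintype G] (l : LinkingPairing G) (k : ℕ+) : Z8bar :=
  if gaussSum l k = 0 then ⊤
  else ((Classical.epsilon fun j : ZMod 8 =>
    gaussSum l k / (‖gaussSum l k‖ : ℂ) = ZMod.stdAddChar j : ZMod 8) : Z8bar)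

theorem sigma_eq_coe [Fintype G] (l : LinkingPairing G) (k : ℕ+) (j : ZMod 8)
    (h0 : gaussSum l k ≠ 0)
    (hj : gaussSum l k / (‖gaussSum l k‖ : ℂ) = ZMod.stdAddChar j) :
    sigma l k = (j : Z8bar) := by
  have h := Classical.epsilon_spec
    (p := fun j : ZMod 8 => gaussSum l k / (‖gaussSum l k‖ : ℂ) = ZMod.stdAddChar j) ⟨j, hj⟩
  rw [sigma, if_neg h0]
  congr 1
  exact ZMod.injective_stdAddChar (h.symm.trans hj)

/-- `H` is an orthogonal decomposition `(G, λ) = ⨁_{k ≥ 1} (G_k, λ_k)` with `G_k = H k` a free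
`ℤ/2^k`-module of finite rank (the restrictions `λ_k` of `λ` are then automatically
nondegenerate). -/
structure IsHomogeneousDecomposition (l : LinkingPairing G) (H : ℕ+ → AddSubgroup G) :
    Prop where
  isInternal : DirectSum.IsInternal H
  orthogonal : ∀ i j : ℕ+, i ≠ j → ∀ x ∈ H i, ∀ y ∈ H j, l.form x y = 0
  free : ∀ k : ℕ+, ∃ n : ℕ, Nonempty (H k ≃+ (Fin n → ZMod (2 ^ (k : ℕ))))

/-- The invariant `ρ_k(λ)` of a linking pairing on a finite `2`-group: the rank of the free
`ℤ/2^k`-module `G_k` in an orthogonal decomposition of `(G, λ)` into homogeneous pieces. -/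
def rho (l : LinkingPairing G) (k : ℕ+) : ℕ :=
  Classical.epsilon fun n : ℕ => ∃ H : ℕ+ → AddSubgroup G,
    IsHomogeneousDecomposition l H ∧ Nonempty (H k ≃+ (Fin n → ZMod (2 ^ (k : ℕ))))

end Invariants

/-! ### Tableaux -/

/-- A tableau on a set `I` of positive integers: `m ↦ (r(m), s(m))`. -/
abbrev Tableau (I : Set ℕ+) : Type := I → ℕ × Z8bar

/-- A tableau on all positive integers. -/
abbrev FullTableau : Type := ℕ+ → ℕ × Z8bar

/-- The formal rank `r(m)`. -/
abbrev FullTableau.r (T : FullTableau) (m : ℕ+) : ℕ := (T m).1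

/-- The formal signature `s(m)`. -/
abbrev FullTableau.s (T : FullTableau) (m : ℕ+) : Z8bar := (T m).2

/-- A tableau on all positive integers is finite if it has finite support. -/
def FullTableau.IsFinite (T : FullTableau) : Prop := (Function.support T).Finite

/-- The tableau on `I` extracted from `T`. -/
def FullTableau.extract (T : FullTableau) (I : Set ℕ+) : Tableau I := fun m => T m

/-- `T` is admissible if it is the tableau `k ↦ (ρ_k(λ), σ_k(λ))` of a linking pairing `λ` on
some finite abelian `2`-group. -/
def FullTableau.Admissible (T : FullTableau) : Prop :=
  ∃ (G : Type) (_ : AddCommGroup G) (_ : Fintype G) (l : LinkingPairing G),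
    (∃ n : ℕ, Nat.card G = 2 ^ n) ∧ ∀ m : ℕ+, T.r m = rho l m ∧ T.s m = sigma l m

/-- An index with entry `(r, s)` is regular if `r = 0` or `s ≠ ∞`. -/
def IsRegularEntry (e : ℕ × Z8bar) : Prop := e.1 = 0 ∨ e.2 ≠ ⊤

/-- The regular indices of a tableau. -/
def FullTableau.IsRegular (T : FullTableau) (m : ℕ+) : Prop := IsRegularEntry (T m)

/-- Type `T₀`: odd length, all formal ranks equal to `0`. -/
def Tableau.IsType0 {I : Set ℕ+} (T : Tableau I) : Prop :=
  Odd I.ncard ∧ ∀ m : I, (T m).1 = 0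

/-- Type `T₁`: a single column `(1, ∞)`. -/
def Tableau.IsType1 {I : Set ℕ+} (T : Tableau I) : Prop :=
  I.ncard = 1 ∧ ∀ m : I, T m = (1, ⊤)

/-- Type `T₂`: a single column `(2, ∞)`. -/
def Tableau.IsType2 {I : Set ℕ+} (T : Tableau I) : Prop :=
  I.ncard = 1 ∧ ∀ m : I, T m = (2, ⊤)

/-- Type `T₃`: odd length, all indices regular. -/
def Tableau.IsType3 {I : Set ℕ+} (T : Tableau I) : Prop :=
  Odd I.ncard ∧ ∀ m : I, IsRegularEntry (T m)

/-- `m` is the left delimiter `inf I - 1` of `I`. -/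
def IsLeftDelimiter (I : Set ℕ+) (m : ℕ+) : Prop := IsLeast I (m + 1)

/-- `n` is the right delimiter `sup I + 1` of `I`. -/
def IsRightDelimiter (I : Set ℕ+) (n : ℕ+) : Prop := ∃ b : ℕ+, IsGreatest I b ∧ n = b + 1

/-- `a ≡ n (mod d)`, for `d ∣ 8`: `a` is not `∞` and reduces to `n` modulo `d`. -/
def CongrMod (d : ℕ) (a : Z8bar) (n : ℕ) : Prop :=
  ∃ x : ZMod 8, a = (x : Z8bar) ∧ (x.cast : ZMod d) = (n : ZMod d)

/-- `a - b ∈ D`; in particular `a` and `b` are not `∞`. -/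
def DiffMem (a b : Z8bar) (D : Set (ZMod 8)) : Prop :=
  ∃ x y : ZMod 8, a = (x : Z8bar) ∧ b = (y : Z8bar) ∧ x - y ∈ D

/-- Condition (1): the formal rank is even at regular indices. -/
def FullTableau.Cond1 (T : FullTableau) : Prop :=
  ∀ m : ℕ+, T.IsRegular m → Even (T.r m)

/-- Condition (2): `s(m) ≡ ∑_{k ≥ m+1} r(k) (mod 2)` at regular indices. -/
def FullTableau.Cond2 (T : FullTableau) : Prop :=
  ∀ m : ℕ+, T.IsRegular m → CongrMod 2 (T.s m) (∑ᶠ (k : ℕ+) (_ : m + 1 ≤ k), T.r k)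

/-- Condition (3): `s(m) + s(m+1) ≡ 2 ∑_{k ≥ m+2} r(k) (mod 4)` if `m`, `m+1` are regular. -/
def FullTableau.Cond3 (T : FullTableau) : Prop :=
  ∀ m : ℕ+, T.IsRegular m → T.IsRegular (m + 1) →
    CongrMod 4 (T.s m + T.s (m + 1)) (2 * ∑ᶠ (k : ℕ+) (_ : m + 2 ≤ k), T.r k)

/-- Condition (4): the constraints on `s(m) - s(n)` for the delimiters `m`, `n` of an extracted
tableau (on a set of consecutive integers), if both delimiters are regular indices. -/
def FullTableau.Cond4 (T : FullTableau) : Prop :=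
  ∀ I : Set ℕ+, I.OrdConnected → ∀ m n : ℕ+, IsLeftDelimiter I m → IsRightDelimiter I n →
    T.IsRegular m → T.IsRegular n →
    ((T.extract I).IsType0 → DiffMem (T.s m) (T.s n) {0}) ∧
    ((T.extract I).IsType1 → DiffMem (T.s m) (T.s n) {1, -1}) ∧
    ((T.extract I).IsType2 → DiffMem (T.s m) (T.s n) {0, 2, -2}) ∧
    ((T.extract I).IsType3 → DiffMem (T.s m) (T.s n) {0, 4})

end

end Enlacement

/-!
Every linking pairing on a finite abelian `2`-group is an orthogonal sum of blocks over the rings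
`ℤ/2^k`: rank one blocks with an odd unit, and rank two blocks with an even form. Gauss sums are
multiplicative along orthogonal sums, so `σ_m` is the sum in `ℤ/8 ∪ {∞}` of the contributions of
the blocks. A block of level `k` contributes nothing to `σ_m` if `k < m`; if `k = m`, it
contributes `∞` when it is odd and nothing otherwise; and if `k > m`, its contribution depends only
on the parity of `k - m`. Admissibility is thereby reduced to a question about sums in `ℤ/8`.

The two possible contributions of a block agree modulo `4`, and both are congruent to its rank
modulo `2`; indices `m` and `n` of the same parity are told apart only by the blocks of level
between `m` and `n`. This yields the four conditions. Conversely, blocks realizing a tableau are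
chosen by descending level. Since the contributions of a level depend only on a parity, the blocks
of level `k` can be chosen by looking at `σ_{k-1}` and `σ_{k-2}` alone: they must produce `σ_{k-1}`
exactly, and leave for `σ_{k-2}` a value which blocks of level `k - 1` are able to supply.
Conditions (3) and (4) say that these two demands are compatible.
-/

namespace Enlacement

noncomputable section

/-! ### Cyclic subgroups of `ℚ/ℤ` -/

section ToQmodZ

variable (N : ℕ) [NeZero N]

/-- The embedding `ℤ/N → ℚ/ℤ`, `x ↦ x / N`. -/
def toQmodZ : ZMod N →+ QmodZ :=
  ZMod.lift N ⟨zmultiplesHom QmodZ ((1 / N : ℚ) : QmodZ), by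
    have hN : (N : ℚ) ≠ 0 := NeZero.ne _
    rw [zmultiplesHom_apply, ← AddCircle.coe_zsmul, AddCircle.coe_eq_zero_iff]
    exact ⟨1, by simp [hN]⟩⟩

theorem toQmodZ_intCast (z : ℤ) : toQmodZ N z = ((z / N : ℚ) : QmodZ) := by
  rw [toQmodZ, ZMod.lift_coe]
  simp only [zmultiplesHom_apply]
  rw [← AddCircle.coe_zsmul, zsmul_eq_mul, mul_one_div]

theorem toQmodZ_injective : Function.Injective (toQmodZ N) := by
  rw [injective_iff_map_eq_zero]
  intro a ha
  obtain ⟨z, rfl⟩ := ZMod.intCast_surjective a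
  have hN : (N : ℚ) ≠ 0 := NeZero.ne _
  obtain ⟨n, hn⟩ := (AddCircle.coe_eq_zero_iff (1 : ℚ)).mp ((toQmodZ_intCast N z).symm.trans ha)
  rw [zsmul_one, eq_div_iff hN, mul_comm] at hn
  exact (ZMod.intCast_zmod_eq_zero_iff_dvd z N).mpr ⟨n, by exact_mod_cast hn.symm⟩

variable {N} in
theorem exists_toQmodZ_intCast_eq {t : QmodZ} (ht : N • t = 0) : ∃ z : ℤ, toQmodZ N z = t := by
  obtain ⟨q, rfl⟩ := QuotientAddGroup.mk_surjective t
  have hN : (N : ℚ) ≠ 0 := NeZero.ne _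
  obtain ⟨n, hn⟩ := (AddCircle.coe_eq_zero_iff (1 : ℚ)).mp ((AddCircle.coe_nsmul (1 : ℚ)).trans ht)
  rw [zsmul_one, nsmul_eq_mul] at hn
  exact ⟨n, by rw [toQmodZ_intCast, hn, mul_div_cancel_left₀ q hN]⟩

variable {N} in
theorem toQmodZ_mul (c a : ZMod N) : toQmodZ N (c * a) = c.val • toQmodZ N a := by
  rw [← map_nsmul, nsmul_eq_mul, ZMod.natCast_zmod_val]

theorem two_pow_nsmul_toQmodZ_eq_zero_iff {k : ℕ} {z : ℤ} :
    2 ^ k • toQmodZ (2 ^ (k + 1)) z = 0 ↔ Even z := by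
  have hcast : 2 ^ k • (z : ZMod (2 ^ (k + 1))) = ((2 ^ k * z : ℤ) : ZMod (2 ^ (k + 1))) := by
    push_cast [nsmul_eq_mul]; rfl
  rw [← map_nsmul, map_eq_zero_iff _ (toQmodZ_injective _), hcast,
    ZMod.intCast_zmod_eq_zero_iff_dvd, Nat.cast_pow, Nat.cast_ofNat, pow_succ,
    mul_dvd_mul_iff_left (by positivity), even_iff_two_dvd]

end ToQmodZ

theorem isUnit_intCast_zmod_two_pow {z : ℤ} (hz : Odd z) (k : ℕ) :
    IsUnit (z : ZMod (2 ^ k)) := by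
  rw [ZMod.coe_int_isUnit_iff_isCoprime, Nat.cast_pow]
  exact (Int.isCoprime_two_left.mpr hz).pow_left

/-! ### Isometries, orthogonal sums and orthogonal complements -/

namespace LinkingPairing

variable {G G' A : Type*} [AddCommGroup G] [AddCommGroup G'] [AddCommGroup A]

/-- Two linking pairings are isometric if some isomorphism of the underlying groups carries one
to the other. -/
def IsIsometric (l : LinkingPairing G) (l' : LinkingPairing G') : Prop :=
  ∃ f : G ≃+ G', ∀ x y, l'.form (f x) (f y) = l.form x y

/-- The orthogonal sum of two linking pairings. -/
def prod (l : LinkingPairing G) (l' : LinkingPairing G') : LinkingPairing (G × G') where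
  form := (l.form.compl₂ (AddMonoidHom.fst G G')).comp (AddMonoidHom.fst G G') +
    (l'.form.compl₂ (AddMonoidHom.snd G G')).comp (AddMonoidHom.snd G G')
  symm x y := congrArg₂ (· + ·) (l.symm _ _) (l'.symm _ _)
  bijective_adjoint := by
    constructor
    · rw [injective_iff_map_eq_zero]
      intro x hx
      refine Prod.ext (l.bijective_adjoint.1 ?_) (l'.bijective_adjoint.1 ?_)
      · ext y; simpa using DFunLike.congr_fun hx (y, 0)
      · ext y; simpa using DFunLike.congr_fun hx (0, y)
    · intro f
      obtain ⟨x, hx⟩ := l.bijective_adjoint.2 (f.comp (AddMonoidHom.inl G G'))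
      obtain ⟨x', hx'⟩ := l'.bijective_adjoint.2 (f.comp (AddMonoidHom.inr G G'))
      refine ⟨(x, x'), AddMonoidHom.ext fun y => ?_⟩
      simp [hx, hx', ← map_add]

theorem prod_form (l : LinkingPairing G) (l' : LinkingPairing G') (x y : G × G') :
    (l.prod l').form x y = l.form x.1 y.1 + l'.form x.2 y.2 := rfl

section Pi

variable {ι : Type*} [Fintype ι] {M : ι → Type*} [∀ i, AddCommGroup (M i)]

/-- The orthogonal sum of a finite family of linking pairings. -/
def pi (l : ∀ i, LinkingPairing (M i)) : LinkingPairing (∀ i, M i) where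
  form := ∑ i, ((l i).form.compl₂ (Pi.evalAddMonoidHom M i)).comp (Pi.evalAddMonoidHom M i)
  symm x y := by
    simp only [AddMonoidHom.finsetSum_apply, AddMonoidHom.comp_apply, AddMonoidHom.compl₂_apply,
      Pi.evalAddMonoidHom_apply, (l _).symm (x _)]
  bijective_adjoint := by
    classical
    have form_single (x : ∀ i, M i) (i : ι) (z : M i) :
        (∑ i, ((l i).form.compl₂ (Pi.evalAddMonoidHom M i)).comp (Pi.evalAddMonoidHom M i)) x
          (Pi.single i z) = (l i).form (x i) z := by
      simp only [AddMonoidHom.finsetSum_apply, AddMonoidHom.comp_apply, AddMonoidHom.compl₂_apply,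
        Pi.evalAddMonoidHom_apply]
      rw [Fintype.sum_eq_single i fun j hj => by rw [Pi.single_eq_of_ne hj, map_zero],
        Pi.single_eq_same]
    constructor
    · rw [injective_iff_map_eq_zero]
      intro x hx
      funext i
      refine (l i).bijective_adjoint.1 (AddMonoidHom.ext fun z => ?_)
      rw [← form_single, hx]
      simp
    · intro f
      choose x hx using fun i => (l i).bijective_adjoint.2 (f.comp (AddMonoidHom.single M i))
      refine ⟨x, AddMonoidHom.functions_ext _ _ _ fun i z => ?_⟩
      rw [form_single, hx]
      rfl

theorem pi_form (l : ∀ i, LinkingPairing (M i)) (x y : ∀ i, M i) :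
    (pi l).form x y = ∑ i, (l i).form (x i) (y i) := by
  simp [pi, AddMonoidHom.finsetSum_apply]

end Pi

section Complement

variable (l : LinkingPairing G) (lA : LinkingPairing A) (φ : A →+ G)

/-- The map `G → A` sending `g` to the element of `A` that represents the functional
`a ↦ λ(g, φ a)`. If `φ` is an isometric embedding, this is the orthogonal projection to `A`. -/
def projection : G →+ A :=
  ((AddEquiv.ofBijective lA.form lA.bijective_adjoint).symm : (A →+ QmodZ) →+ A).comp
    (l.form.compl₂ φ)

theorem form_projection (g : G) (a : A) : lA.form (l.projection lA φ g) a = l.form g (φ a) :=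
  DFunLike.congr_fun
    ((AddEquiv.ofBijective lA.form lA.bijective_adjoint).apply_symm_apply (l.form.compl₂ φ g)) a

variable {l lA φ}

theorem projection_apply_self (hφ : ∀ a b, l.form (φ a) (φ b) = lA.form a b) (a : A) :
    l.projection lA φ (φ a) = a :=
  lA.bijective_adjoint.1 (AddMonoidHom.ext fun b => by rw [form_projection, hφ])

theorem form_eq_zero_of_mem_ker_projection {g : G} (hg : g ∈ (l.projection lA φ).ker) (a : A) :
    l.form g (φ a) = 0 := by
  rw [← form_projection l lA φ, AddMonoidHom.mem_ker.mp hg, map_zero, AddMonoidHom.zero_apply]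

/-- The decomposition of `G` into an isometrically embedded `A` and its orthogonal complement. -/
def complementEquiv (hφ : ∀ a b, l.form (φ a) (φ b) = lA.form a b) :
    G ≃+ A × (l.projection lA φ).ker :=
  AddEquiv.symm <| AddEquiv.ofBijective (φ.coprod (l.projection lA φ).ker.subtype) <| by
    constructor
    · rw [injective_iff_map_eq_zero]
      rintro ⟨a, g⟩ h
      have hsum : φ a + g = 0 := h
      have ha : a = 0 := by
        have := congrArg (l.projection lA φ) hsum
        rwa [map_add, projection_apply_self hφ, AddMonoidHom.mem_ker.mp g.2, add_zero,
          map_zero] at this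
      subst ha
      exact Prod.ext rfl (Subtype.ext (by simpa using hsum))
    · intro g
      refine ⟨(l.projection lA φ g, ⟨g - φ (l.projection lA φ g), ?_⟩), add_sub_cancel _ _⟩
      rw [AddMonoidHom.mem_ker, map_sub, projection_apply_self hφ, sub_self]

theorem complementEquiv_symm_apply (hφ : ∀ a b, l.form (φ a) (φ b) = lA.form a b)
    (p : A × (l.projection lA φ).ker) : (complementEquiv hφ).symm p = φ p.1 + p.2 := rfl

theorem form_complementEquiv_symm (hφ : ∀ a b, l.form (φ a) (φ b) = lA.form a b)
    (p q : A × (l.projection lA φ).ker) :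
    l.form ((complementEquiv hφ).symm p) ((complementEquiv hφ).symm q) =
      lA.form p.1 q.1 + l.form p.2 q.2 := by
  rw [complementEquiv_symm_apply, complementEquiv_symm_apply, map_add, map_add,
    AddMonoidHom.add_apply, AddMonoidHom.add_apply, hφ, l.symm (φ p.1) q.2,
    form_eq_zero_of_mem_ker_projection q.2.2, form_eq_zero_of_mem_ker_projection p.2.2,
    zero_add, add_zero]

/-- The restriction of a linking pairing to the orthogonal complement of an isometrically
embedded linking pairing. -/
def complement (hφ : ∀ a b, l.form (φ a) (φ b) = lA.form a b) :
    LinkingPairing (l.projection lA φ).ker where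
  form := (l.form.compl₂ (AddSubgroup.subtype _)).comp (AddSubgroup.subtype _)
  symm x y := l.symm _ _
  bijective_adjoint := by
    let E := complementEquiv hφ
    have form_right (x : (l.projection lA φ).ker) (g : G) : l.form x g = l.form x (E g).2 := by
      have h := form_complementEquiv_symm hφ (0, x) (E g)
      rwa [complementEquiv_symm_apply, AddEquiv.symm_apply_apply, map_zero, map_zero, zero_add,
        AddMonoidHom.zero_apply, zero_add] at h
    constructor
    · rw [injective_iff_map_eq_zero]
      intro x hx
      refine Subtype.ext (l.bijective_adjoint.1 (AddMonoidHom.ext fun g => ?_))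
      rw [form_right]
      simpa using DFunLike.congr_fun hx (E g).2
    · intro f
      obtain ⟨g, hg⟩ :=
        l.bijective_adjoint.2 ((f.comp (AddMonoidHom.snd _ _)).comp (E : G →+ A × _))
      refine ⟨(E g).2, AddMonoidHom.ext fun y => ?_⟩
      have hEy : E (y : G) = (0, y) := by
        rw [← AddEquiv.eq_symm_apply, complementEquiv_symm_apply, map_zero, zero_add]
      calc l.form (E g).2 y = l.form g y := by
            rw [l.symm, ← form_right, l.symm]
        _ = f y := by simp [hg, hEy]

theorem isIsometric_prod_complement (hφ : ∀ a b, l.form (φ a) (φ b) = lA.form a b) :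
    l.IsIsometric (lA.prod (complement hφ)) :=
  ⟨complementEquiv hφ, fun x y => by
    rw [prod_form, ← (complementEquiv hφ).symm_apply_apply x,
      ← (complementEquiv hφ).symm_apply_apply y, form_complementEquiv_symm]
    simp only [AddEquiv.apply_symm_apply]
    rfl⟩

end Complement

/-! ### Linking pairings given by matrices -/

section Matrix

open Matrix

variable {n : Type*} [Fintype n] {N : ℕ} [NeZero N]

/-- The homomorphism `(ℤ/N)ⁿ → G` sending the standard basis to the family `x`. -/
def ofTorsionFamily (x : n → G) (hx : ∀ i, N • x i = 0) : (n → ZMod N) →+ G :=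
  ∑ i, (ZMod.lift N ⟨zmultiplesHom G (x i), by simpa using hx i⟩).comp
    (Pi.evalAddMonoidHom (fun _ => ZMod N) i)

theorem ofTorsionFamily_apply (x : n → G) (hx : ∀ i, N • x i = 0) (a : n → ZMod N) :
    ofTorsionFamily x hx a = ∑ i, (a i).val • x i := by
  simp only [ofTorsionFamily, AddMonoidHom.finsetSum_apply, AddMonoidHom.comp_apply,
    Pi.evalAddMonoidHom_apply]
  refine Finset.sum_congr rfl fun i _ => ?_
  conv_lhs => rw [← ZMod.natCast_zmod_val (a i), ← Int.cast_natCast (a i).val]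
  rw [ZMod.lift_coe]
  simp only [zmultiplesHom_apply, natCast_zsmul]

variable [DecidableEq n]

/-- The linking pairing `(x, y) ↦ xᵀ A y / N` on `(ℤ/N)ⁿ`. -/
def ofMatrix (A : Matrix n n (ZMod N)) (hA : A.IsSymm) (hdet : IsUnit A.det) :
    LinkingPairing (n → ZMod N) where
  form := AddMonoidHom.mk' (fun x => AddMonoidHom.mk' (fun y => toQmodZ N (x ⬝ᵥ A *ᵥ y))
      (fun y z => by rw [mulVec_add, dotProduct_add, map_add]))
    (fun x y => by ext z; simp [add_dotProduct, map_add])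
  symm x y := by
    simp only [AddMonoidHom.mk'_apply]
    rw [dotProduct_mulVec, dotProduct_comm, ← mulVec_transpose, hA.eq]
  bijective_adjoint := by
    have dotProduct_single (x : n → ZMod N) (i : n) : x ⬝ᵥ A *ᵥ Pi.single i 1 = (A *ᵥ x) i := by
      rw [dotProduct_mulVec, dotProduct_single_one, ← mulVec_transpose, hA.eq]
    constructor
    · rw [injective_iff_map_eq_zero]
      intro x hx
      refine mulVec_injective_of_isUnit ((isUnit_iff_isUnit_det A).mpr hdet) ?_
      funext i
      refine toQmodZ_injective N ?_
      rw [← dotProduct_single]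
      simpa using DFunLike.congr_fun hx (Pi.single i 1)
    · intro f
      have hf (i : n) : N • f (Pi.single i 1) = 0 := by
        rw [← map_nsmul, ← Pi.single_smul]; simp
      choose a ha using fun i => exists_toQmodZ_intCast_eq (hf i)
      refine ⟨A⁻¹ *ᵥ fun i => (a i : ZMod N), AddMonoidHom.functions_ext _ _ _ fun i z => ?_⟩
      have hz : (Pi.single i z : n → ZMod N) = z.val • Pi.single i 1 := by
        rw [← Pi.single_smul]; simp
      rw [hz, map_nsmul, map_nsmul, ← ha]
      simp only [AddMonoidHom.mk'_apply]
      rw [dotProduct_single, mulVec_mulVec, mul_nonsing_inv A hdet, one_mulVec]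

theorem ofMatrix_form (A : Matrix n n (ZMod N)) (hA : A.IsSymm) (hdet : IsUnit A.det)
    (x y : n → ZMod N) : (ofMatrix A hA hdet).form x y = toQmodZ N (x ⬝ᵥ A *ᵥ y) := rfl

theorem form_ofTorsionFamily (l : LinkingPairing G) {A : Matrix n n (ZMod N)} (hA : A.IsSymm)
    (hdet : IsUnit A.det) {x : n → G} (hx : ∀ i, N • x i = 0)
    (hgram : ∀ i j, l.form (x i) (x j) = toQmodZ N (A i j)) (a b : n → ZMod N) :
    l.form (ofTorsionFamily x hx a) (ofTorsionFamily x hx b) = (ofMatrix A hA hdet).form a b := by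
  simp only [ofTorsionFamily_apply, map_sum, AddMonoidHom.finsetSum_apply, map_nsmul,
    AddMonoidHom.nsmul_apply, hgram, ofMatrix_form, dotProduct, mulVec, toQmodZ_mul,
    Finset.smul_sum]
  rw [Finset.sum_comm]
  refine Finset.sum_congr rfl fun i _ => Finset.sum_congr rfl fun j _ => ?_
  rw [← toQmodZ_mul, ← toQmodZ_mul, ← toQmodZ_mul, ← toQmodZ_mul, mul_left_comm, mul_comm (b j)]

theorem exists_isIsometric_ofMatrix_prod (l : LinkingPairing G) {A : Matrix n n (ZMod N)}
    (hA : A.IsSymm) (hdet : IsUnit A.det) {x : n → G} (hx : ∀ i, N • x i = 0)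
    (hgram : ∀ i j, l.form (x i) (x j) = toQmodZ N (A i j)) :
    ∃ (K : AddSubgroup G) (lK : LinkingPairing K),
      l.IsIsometric ((ofMatrix A hA hdet).prod lK) :=
  ⟨_, _, isIsometric_prod_complement (form_ofTorsionFamily l hA hdet hx hgram)⟩

end Matrix

end LinkingPairing

/-! ### Quadratic Gauss sums modulo powers of two -/

/-- The character `q ↦ exp(2π√-1 q)` of `ℚ`. -/
def e : AddChar ℚ ℂ where
  toFun q := Complex.exp (2 * Real.pi * Complex.I * q)
  map_zero_eq_one' := by simp
  map_add_eq_mul' p q := by rw [← Complex.exp_add]; congr 1; push_cast; ring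

theorem e_apply (q : ℚ) : e q = Complex.exp (2 * Real.pi * Complex.I * q) := rfl

theorem e_intCast (z : ℤ) : e z = 1 := by
  rw [e_apply, Complex.exp_eq_one_iff]
  exact ⟨z, by push_cast; ring⟩

theorem e_odd_div_two {z : ℤ} (hz : Odd z) : e (z / 2) = -1 := by
  obtain ⟨j, rfl⟩ := hz
  have hj : ((2 * j + 1 : ℤ) : ℚ) / 2 = j + 1 / 2 := by push_cast; ring
  rw [hj, AddChar.map_add_eq_mul, e_intCast, one_mul, e_apply, ← Complex.exp_pi_mul_I]
  congr 1; push_cast; ring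

theorem e_eq_of_eq_add_int {p q : ℚ} (z : ℤ) (h : p = q + z) : e p = e q := by
  rw [h, AddChar.map_add_eq_mul, e_intCast, mul_one]

theorem e_eq_neg_of_eq_add_half {p q : ℚ} {z : ℤ} (hz : Odd z) (h : p = q + z / 2) :
    e p = -e q := by
  rw [h, AddChar.map_add_eq_mul, e_odd_div_two hz, mul_neg_one]

theorem e_add_e_neg (q : ℚ) : e q + e (-q) = (2 * Real.cos (2 * Real.pi * q) : ℝ) := by
  rw [e_apply, e_apply]
  push_cast
  rw [Complex.two_cos]
  congr 2 <;> ring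

theorem stdAddChar_intCast (z : ℤ) : ZMod.stdAddChar (z : ZMod 8) = e (z / 8) := by
  rw [ZMod.stdAddChar_coe, e_apply]
  congr 1; push_cast; ring

theorem phase_coe (k : ℕ+) (q : ℚ) : phase k (q : QmodZ) = e (2 ^ (k : ℕ) * q / 2) := by
  rw [phase, Function.Periodic.lift_coe, e_apply]
  congr 1; push_cast; ring

theorem phase_zero (k : ℕ+) : phase k 0 = 1 := by
  rw [← AddCircle.coe_zero, phase_coe, mul_zero, zero_div, AddChar.map_zero_eq_one]

theorem phase_add (k : ℕ+) (s t : QmodZ) : phase k (s + t) = phase k s * phase k t := by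
  induction s using QuotientAddGroup.induction_on with | H p
  induction t using QuotientAddGroup.induction_on with | H q
  rw [← AddCircle.coe_add, phase_coe, phase_coe, phase_coe, mul_add, add_div,
    AddChar.map_add_eq_mul]

theorem phase_sum {ι : Type*} (s : Finset ι) (k : ℕ+) (f : ι → QmodZ) :
    phase k (∑ i ∈ s, f i) = ∏ i ∈ s, phase k (f i) := by
  classical
  induction s using Finset.induction_on with
  | empty => exact phase_zero k
  | insert i s hi ih => rw [Finset.sum_insert hi, Finset.prod_insert hi, phase_add, ih]

theorem phase_toQmodZ (m : ℕ+) (N : ℕ) [NeZero N] (z : ℤ) :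
    phase m (toQmodZ N z) = e (z * 2 ^ (m : ℕ) / (2 * N)) := by
  rw [toQmodZ_intCast, phase_coe]
  congr 1
  ring

namespace LinkingPairing

theorem IsIsometric.gaussSum_eq {G G' : Type*} [AddCommGroup G] [Fintype G] [AddCommGroup G']
    [Fintype G'] {l : LinkingPairing G} {l' : LinkingPairing G'} (h : l.IsIsometric l')
    (k : ℕ+) : gaussSum l k = gaussSum l' k :=
  let ⟨f, hf⟩ := h
  Fintype.sum_equiv f.toEquiv _ _ fun x => congrArg (phase k) (hf x x).symm

theorem gaussSum_pi {ι : Type*} [Fintype ι] [DecidableEq ι] {M : ι → Type*}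
    [∀ i, AddCommGroup (M i)] [∀ i, Fintype (M i)] (l : ∀ i, LinkingPairing (M i)) (k : ℕ+) :
    gaussSum (pi l) k = ∏ i, gaussSum (l i) k := by
  simp only [gaussSum, pi_form, phase_sum]
  exact (Fintype.prod_sum fun i x => phase k ((l i).form x x)).symm

end LinkingPairing

/-- `z` is a positive multiple of `exp(2π√-1 j / 8)`. -/
def HasPhase (z : ℂ) (j : ZMod 8) : Prop := ∃ c : ℝ, 0 < c ∧ z = c * ZMod.stdAddChar j

namespace HasPhase

variable {z w : ℂ} {i j : ZMod 8}

theorem of_pos {c : ℝ} (hc : 0 < c) : HasPhase c 0 :=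
  ⟨c, hc, by rw [AddChar.map_zero_eq_one, mul_one]⟩

theorem mul (hz : HasPhase z i) (hw : HasPhase w j) : HasPhase (z * w) (i + j) := by
  obtain ⟨c, hc, rfl⟩ := hz
  obtain ⟨d, hd, rfl⟩ := hw
  exact ⟨c * d, mul_pos hc hd, by rw [AddChar.map_add_eq_mul]; push_cast; ring⟩

theorem pos_mul (hz : HasPhase z j) {c : ℝ} (hc : 0 < c) : HasPhase (c * z) j := by
  simpa only [zero_add] using (of_pos hc).mul hz

theorem prod {ι : Type*} (s : Finset ι) {z : ι → ℂ} {j : ι → ZMod 8}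
    (h : ∀ i ∈ s, HasPhase (z i) (j i)) : HasPhase (∏ i ∈ s, z i) (∑ i ∈ s, j i) := by
  classical
  induction s using Finset.induction_on with
  | empty => simpa using of_pos one_pos
  | insert a s ha ih =>
    rw [Finset.prod_insert ha, Finset.sum_insert ha]
    exact (h a (Finset.mem_insert_self a s)).mul
      (ih fun i hi => h i (Finset.mem_insert_of_mem hi))

theorem ne_zero (h : HasPhase z j) : z ≠ 0 := by
  obtain ⟨c, hc, rfl⟩ := h
  refine mul_ne_zero (Complex.ofReal_ne_zero.mpr hc.ne') (norm_ne_zero_iff.mp ?_)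
  rw [AddChar.norm_apply]
  exact one_ne_zero

theorem div_norm (h : HasPhase z j) : z / (‖z‖ : ℂ) = ZMod.stdAddChar j := by
  obtain ⟨c, hc, rfl⟩ := h
  rw [norm_mul, AddChar.norm_apply, mul_one, Complex.norm_of_nonneg hc.le,
    mul_div_cancel_left₀ _ (Complex.ofReal_ne_zero.mpr hc.ne')]

end HasPhase

theorem sum_range_mul_of_periodic {M : Type*} [AddCommMonoid M] {f : ℕ → M} {p : ℕ}
    (hf : Function.Periodic f p) (c : ℕ) :
    ∑ x ∈ Finset.range (p * c), f x = c • ∑ x ∈ Finset.range p, f x := by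
  induction c with
  | zero => simp
  | succ c ih =>
    rw [Nat.mul_succ, Finset.sum_range_add, ih, succ_nsmul]
    refine congrArg _ (Finset.sum_congr rfl fun x _ => ?_)
    rw [add_comm, mul_comm]
    exact hf.nat_mul c x

theorem sum_range_mul_of_antiperiodic {M : Type*} [AddCommGroup M] {f : ℕ → M} {p : ℕ}
    (hf : Function.Antiperiodic f p) (c : ℕ) : ∑ x ∈ Finset.range (2 * p * c), f x = 0 := by
  have hp : ∑ x ∈ Finset.range (2 * p), f x = 0 := by
    rw [two_mul, Finset.sum_range_add, ← Finset.sum_add_distrib]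
    exact Finset.sum_eq_zero fun x _ => by rw [add_comm p, hf, add_neg_cancel]
  rw [sum_range_mul_of_periodic (by simpa using hf.periodic_two_mul), hp, smul_zero]

theorem sum_range_two_mul {M : Type*} [AddCommMonoid M] (N : ℕ) (f : ℕ → M) :
    ∑ x ∈ Finset.range (2 * N), f x =
      ∑ y ∈ Finset.range N, f (2 * y) + ∑ y ∈ Finset.range N, f (2 * y + 1) := by
  induction N with
  | zero => simp
  | succ N ih =>
    rw [Nat.mul_succ, Finset.sum_range_succ, Finset.sum_range_succ, ih, Finset.sum_range_succ,
      Finset.sum_range_succ]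
    abel

section OddGaussSum

/-- The Gauss sum of the form `n x²` modulo `2 ^ d`. -/
def oddGaussSum (d : ℕ) (n : ℤ) : ℂ :=
  ∑ x ∈ Finset.range (2 ^ d), e (n * (x : ℚ) ^ 2 / 2 ^ d)

theorem periodic_oddGaussSum_term (d : ℕ) (n : ℤ) :
    Function.Periodic (fun x : ℕ => e (n * (x : ℚ) ^ 2 / 2 ^ d)) (2 ^ d) := fun x =>
  e_eq_of_eq_add_int (n * (2 * x + 2 ^ d)) (by push_cast; field_simp; ring)

variable {n : ℤ}

theorem oddGaussSum_one (hn : Odd n) : oddGaussSum 1 n = 0 := by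
  simp [oddGaussSum, Finset.sum_range_succ, e_odd_div_two hn]

theorem oddGaussSum_two (n : ℤ) : oddGaussSum 2 n = 2 * (1 + e (n / 4)) := by
  have heven (y : ℕ) : e (n * ((2 * y : ℕ) : ℚ) ^ 2 / 2 ^ 2) = 1 := by
    rw [← e_intCast (n * y ^ 2)]
    congr 1; push_cast; ring
  have hodd (y : ℕ) : e (n * ((2 * y + 1 : ℕ) : ℚ) ^ 2 / 2 ^ 2) = e (n / 4) :=
    e_eq_of_eq_add_int (n * (y ^ 2 + y)) (by push_cast; ring)
  rw [oddGaussSum, pow_two 2, sum_range_two_mul]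
  simp only [heven, hodd, Finset.sum_const, Finset.card_range, nsmul_eq_mul]
  push_cast; ring

theorem hasPhase_oddGaussSum_two (hn : Odd n) :
    HasPhase (oddGaussSum 2 n) ((ZMod.χ₄ n : ℤ) : ZMod 8) := by
  obtain ⟨ε, hε, hχ, q, hq⟩ : ∃ ε : ℤ, (ε = 1 ∨ ε = -1) ∧ ZMod.χ₄ n = ε ∧ ∃ q, n = 4 * q + ε := by
    have hmod : n % 4 = 1 ∨ n % 4 = 3 := by have := Int.odd_iff.mp hn; omega
    rcases hmod with h | h
    · exact ⟨1, .inl rfl, ZMod.χ₄_int_one_mod_four h, n / 4, by omega⟩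
    · exact ⟨-1, .inr rfl, ZMod.χ₄_int_three_mod_four h, n / 4 + 1, by omega⟩
  have hfactor : 1 + e (n / 4) = (e (ε / 8) + e (-(ε / 8))) * e (ε / 8) := by
    rw [add_mul, ← AddChar.map_add_eq_mul, ← AddChar.map_add_eq_mul, neg_add_cancel,
      AddChar.map_zero_eq_one, add_comm, hq]
    exact congrArg (· + 1) (e_eq_of_eq_add_int q (by push_cast; ring))
  have hcos : Real.cos (2 * Real.pi * (ε / 8 : ℚ)) = Real.sqrt 2 / 2 := by
    rw [← Real.cos_pi_div_four]
    rcases hε with rfl | rfl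
    · congr 1; push_cast; ring
    · rw [← Real.cos_neg (Real.pi / 4)]; congr 1; push_cast; ring
  refine ⟨2 * Real.sqrt 2, by positivity, ?_⟩
  rw [oddGaussSum_two, hχ, stdAddChar_intCast, hfactor, e_add_e_neg, hcos]
  push_cast; ring

theorem oddGaussSum_three (hn : Odd n) : oddGaussSum 3 n = 4 * e (n / 8) := by
  have heven : ∑ y ∈ Finset.range 4, e (n * ((2 * y : ℕ) : ℚ) ^ 2 / 2 ^ 3) = 0 :=
    sum_range_mul_of_antiperiodic (p := 1) (fun y =>
      e_eq_neg_of_eq_add_half (z := n * (2 * y + 1)) (hn.mul (odd_two_mul_add_one _))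
        (by push_cast; ring)) 2
  have hodd (y : ℕ) : e (n * ((2 * y + 1 : ℕ) : ℚ) ^ 2 / 2 ^ 3) = e (n / 8) := by
    obtain ⟨t, ht⟩ : Even ((y : ℤ) * (y + 1)) := Int.even_mul_succ_self y
    have ht' : (y : ℚ) * (y + 1) = t + t := by exact_mod_cast ht
    exact e_eq_of_eq_add_int (n * t) (by push_cast; linear_combination (n / 2 : ℚ) * ht')
  rw [oddGaussSum, show 2 ^ 3 = 2 * 4 by rfl, sum_range_two_mul, heven]
  simp only [hodd, Finset.sum_const, Finset.card_range, nsmul_eq_mul, zero_add, Nat.cast_ofNat]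

theorem hasPhase_oddGaussSum_three (hn : Odd n) : HasPhase (oddGaussSum 3 n) (n : ZMod 8) :=
  ⟨4, by norm_num, by rw [oddGaussSum_three hn, stdAddChar_intCast, Complex.ofReal_ofNat]⟩

theorem oddGaussSum_add_four (hn : Odd n) (d : ℕ) :
    oddGaussSum (d + 4) n = 2 * oddGaussSum (d + 2) n := by
  have hodd : ∑ y ∈ Finset.range (2 * 2 ^ (d + 1) * 2),
      e (n * ((2 * y + 1 : ℕ) : ℚ) ^ 2 / 2 ^ (d + 4)) = 0 :=
    sum_range_mul_of_antiperiodic (fun y =>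
      e_eq_neg_of_eq_add_half (z := n * (2 * (y + 2 ^ d) + 1)) (hn.mul (odd_two_mul_add_one _))
        (by push_cast; field_simp; ring)) 2
  have heven (y : ℕ) : n * ((2 * y : ℕ) : ℚ) ^ 2 / 2 ^ (d + 4) = n * (y : ℚ) ^ 2 / 2 ^ (d + 2) := by
    push_cast; field_simp; ring
  rw [oddGaussSum, show 2 ^ (d + 4) = 2 * (2 * 2 ^ (d + 1) * 2) by ring, sum_range_two_mul, hodd,
    add_zero, show 2 * 2 ^ (d + 1) * 2 = 2 ^ (d + 2) * 2 by ring]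
  simp only [heven]
  rw [sum_range_mul_of_periodic (periodic_oddGaussSum_term (d + 2) n), nsmul_eq_mul,
    Nat.cast_ofNat, oddGaussSum]

theorem hasPhase_oddGaussSum (hn : Odd n) (d : ℕ) :
    HasPhase (oddGaussSum (d + 2) n)
      (if Even d then ((ZMod.χ₄ n : ℤ) : ZMod 8) else (n : ZMod 8)) := by
  induction d using Nat.twoStepInduction with
  | zero => simpa using hasPhase_oddGaussSum_two hn
  | one => simpa using hasPhase_oddGaussSum_three hn
  | more d ih _ =>
    simp only [oddGaussSum_add_four hn, Nat.even_add, iff_true_right even_two]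
    exact_mod_cast ih.pos_mul two_pos

end OddGaussSum

section EvenGaussSum

/-- The Gauss sum of the form `a x² + x y + c y²` modulo `2 ^ d`. -/
def evenGaussSum (d : ℕ) (a c : ℤ) : ℂ :=
  ∑ x ∈ Finset.range (2 ^ d), ∑ y ∈ Finset.range (2 ^ d),
    e ((a * (x : ℚ) ^ 2 + x * y + c * (y : ℚ) ^ 2) / 2 ^ d)

variable (a c : ℤ)

theorem periodic_evenGaussSum_term (d x : ℕ) :
    Function.Periodic (fun y : ℕ => e ((a * (x : ℚ) ^ 2 + x * y + c * (y : ℚ) ^ 2) / 2 ^ d))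
      (2 ^ d) := fun y =>
  e_eq_of_eq_add_int (x + c * (2 * y + 2 ^ d)) (by push_cast; field_simp; ring)

theorem sum_range_two_pow_mul_evenGaussSum_term (d s : ℕ) :
    ∑ x ∈ Finset.range (2 ^ d * s), ∑ y ∈ Finset.range (2 ^ d * s),
      e ((a * (x : ℚ) ^ 2 + x * y + c * (y : ℚ) ^ 2) / 2 ^ d) = s ^ 2 * evenGaussSum d a c := by
  simp only [sum_range_mul_of_periodic (periodic_evenGaussSum_term a c d _), ← Finset.smul_sum]
  rw [sum_range_mul_of_periodic, smul_smul, nsmul_eq_mul, Nat.cast_mul, sq, evenGaussSum]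
  exact fun x => Finset.sum_congr rfl fun y _ =>
    e_eq_of_eq_add_int (y + a * (2 * x + 2 ^ d)) (by push_cast; field_simp; ring)

theorem evenGaussSum_zero : evenGaussSum 0 a c = 1 := by simp [evenGaussSum]

theorem evenGaussSum_one : evenGaussSum 1 a c = if Odd a ∧ Odd c then -2 else 2 := by
  have hterm (x y : ℕ) : e ((a * (x : ℚ) ^ 2 + x * y + c * (y : ℚ) ^ 2) / 2) =
      if Odd (a * x ^ 2 + x * y + c * y ^ 2) then -1 else 1 := by
    split_ifs with h
    · rw [← e_odd_div_two h]; congr 1; push_cast; ring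
    · obtain ⟨z, hz⟩ := Int.not_odd_iff_even.mp h
      rw [← e_intCast z]
      have hz' : a * (x : ℚ) ^ 2 + x * y + c * (y : ℚ) ^ 2 = z + z := by exact_mod_cast hz
      rw [hz', add_self_div_two]
  rw [evenGaussSum]
  simp only [pow_one, hterm, Finset.sum_range_succ, Finset.sum_range_zero]
  by_cases ha : Odd a <;> by_cases hc : Odd c <;>
    norm_num [Int.odd_add, ← Int.not_odd_iff_even, ha, hc]

theorem evenGaussSum_add_two (d : ℕ) : evenGaussSum (d + 2) a c = 4 * evenGaussSum d a c := by
  have hx (x : ℕ) : ∑ y ∈ Finset.range (2 * 2 ^ (d + 1) * 1), e ((a * ((2 * x + 1 : ℕ) : ℚ) ^ 2 +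
      (2 * x + 1 : ℕ) * y + c * (y : ℚ) ^ 2) / 2 ^ (d + 2)) = 0 :=
    sum_range_mul_of_antiperiodic (fun y =>
      e_eq_neg_of_eq_add_half (z := 2 * (x + c * (y + 2 ^ d)) + 1) (odd_two_mul_add_one _)
        (by push_cast; field_simp; ring)) 1
  have hy (y : ℕ) : ∑ x ∈ Finset.range (2 * 2 ^ d * 1), e ((a * ((2 * x : ℕ) : ℚ) ^ 2 +
      (2 * x : ℕ) * (2 * y + 1 : ℕ) + c * ((2 * y + 1 : ℕ) : ℚ) ^ 2) / 2 ^ (d + 2)) = 0 :=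
    sum_range_mul_of_antiperiodic (fun x =>
      e_eq_neg_of_eq_add_half (z := 2 * (y + a * (2 * x + 2 ^ d)) + 1) (odd_two_mul_add_one _)
        (by push_cast; field_simp; ring)) 1
  have hxy (x y : ℕ) : (a * ((2 * x : ℕ) : ℚ) ^ 2 + (2 * x : ℕ) * (2 * y : ℕ) +
      c * ((2 * y : ℕ) : ℚ) ^ 2) / 2 ^ (d + 2) =
      (a * (x : ℚ) ^ 2 + x * y + c * (y : ℚ) ^ 2) / 2 ^ d := by
    push_cast; field_simp; ring
  rw [evenGaussSum, show 2 ^ (d + 2) = 2 * (2 ^ d * 2) by ring, sum_range_two_mul]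
  rw [show 2 * 2 ^ (d + 1) * 1 = 2 * (2 ^ d * 2) by ring] at hx
  rw [show 2 * 2 ^ d * 1 = 2 ^ d * 2 by ring] at hy
  simp only [hx, sum_range_two_mul _ fun _ => e _, Finset.sum_add_distrib]
  rw [Finset.sum_comm (f := fun x y => e ((a * ((2 * x : ℕ) : ℚ) ^ 2 +
      (2 * x : ℕ) * (2 * y + 1 : ℕ) + c * ((2 * y + 1 : ℕ) : ℚ) ^ 2) / 2 ^ (d + 2)))]
  simp only [hy, hxy, sum_range_two_pow_mul_evenGaussSum_term]
  norm_num

theorem hasPhase_evenGaussSum (d : ℕ) :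
    HasPhase (evenGaussSum d a c) (if Odd d ∧ Odd a ∧ Odd c then 4 else 0) := by
  induction d using Nat.twoStepInduction with
  | zero => simpa [evenGaussSum_zero] using HasPhase.of_pos one_pos
  | one =>
    have h4 : ZMod.stdAddChar (4 : ZMod 8) = -1 := by
      rw [← e_odd_div_two odd_one, ← Int.cast_ofNat, stdAddChar_intCast]
      norm_num
    refine ⟨2, two_pos, ?_⟩
    simp only [evenGaussSum_one, odd_one, true_and]
    split_ifs <;> simp [h4]
  | more d ih _ =>
    simp only [evenGaussSum_add_two, Nat.odd_add, iff_true_right even_two]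
    exact_mod_cast ih.pos_mul (c := 4) (by norm_num)

end EvenGaussSum

/-! ### Indecomposable blocks -/

/-- The kind of an indecomposable linking pairing over `ℤ/2^k`: `odd j` is the rank one pairing
with Gram matrix `(2j+1)`, and `even a c` is the rank two pairing with rows `(2a, 1)`, `(1, 2c)`. -/
inductive Kind where
  | odd (j : ℤ) : Kind
  | even (a c : ℤ) : Kind

namespace Kind

/-- The rank of a block. -/
abbrev rank : Kind → ℕ
  | odd _ => 1
  | even _ _ => 2

/-- The integral Gram matrix of a block. -/
def gram : (κ : Kind) → Matrix (Fin κ.rank) (Fin κ.rank) ℤ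
  | odd j => !![2 * j + 1]
  | even a c => !![2 * a, 1; 1, 2 * c]

/-- The Gram matrix of a block modulo `N`. -/
def gramMod (κ : Kind) (N : ℕ) : Matrix (Fin κ.rank) (Fin κ.rank) (ZMod N) :=
  κ.gram.map (Int.castRingHom (ZMod N))

theorem gramMod_isSymm (κ : Kind) (N : ℕ) : (κ.gramMod N).IsSymm := by
  have hgram : κ.gram.IsSymm := by
    cases κ <;> (ext i j; fin_cases i <;> fin_cases j <;> rfl)
  exact hgram.map _

theorem isUnit_det_gramMod (κ : Kind) (k : ℕ) : IsUnit (κ.gramMod (2 ^ k)).det := by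
  have hdet : Odd κ.gram.det := by
    cases κ with
    | odd j => simp [gram]
    | even a c =>
      rw [gram, Matrix.det_fin_two_of]
      exact ⟨2 * a * c - 1, by ring⟩
  rw [gramMod, ← RingHom.mapMatrix_apply, ← RingHom.map_det]
  exact isUnit_intCast_zmod_two_pow hdet k

/-- The blocks of odd kind are those on which `x ↦ 2^(k-1) λ(x, x)` does not vanish. -/
def IsOdd : Kind → Prop
  | odd _ => True
  | even _ _ => False

/-- The contribution of a block over `ℤ/2^k` to `σ_m` if `k - m` is positive and odd. -/
def sigOddGap : Kind → ZMod 8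
  | odd j => (ZMod.χ₄ ((2 * j + 1 : ℤ) : ZMod 4) : ℤ)
  | even a c => if Odd a ∧ Odd c then 4 else 0

/-- The contribution of a block over `ℤ/2^k` to `σ_m` if `k - m` is positive and even. -/
def sigEvenGap : Kind → ZMod 8
  | odd j => (2 * j + 1 : ℤ)
  | even _ _ => 0

end Kind

/-- An indecomposable linking pairing over `ℤ/2^level`, given by its kind. -/
structure Block where
  level : ℕ+
  kind : Kind

namespace Block

/-- The underlying group of a block. -/
abbrev Carrier (b : Block) : Type := Fin b.kind.rank → ZMod (2 ^ (b.level : ℕ))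

/-- The linking pairing of a block. -/
def pairing (b : Block) : LinkingPairing b.Carrier :=
  .ofMatrix (b.kind.gramMod _) (b.kind.gramMod_isSymm _) (b.kind.isUnit_det_gramMod _)

/-- The contribution of a block to `σ_m`, provided that it is finite. The index `m` is an integer
to make sense of `σ_0` and `σ_{-1}` formally. -/
def sig (b : Block) (m : ℤ) : ZMod 8 :=
  if b.level ≤ m then 0
  else if Odd (b.level - m : ℤ) then b.kind.sigOddGap else b.kind.sigEvenGap

end Block

theorem sum_zmod_eq_sum_range {M : Type*} [AddCommMonoid M] (N : ℕ) [NeZero N] (f : ZMod N → M) :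
    ∑ x, f x = ∑ x ∈ Finset.range N, f (x : ℤ) :=
  Finset.sum_bij' (fun x _ => x.val) (fun x _ => (x : ZMod N))
    (fun x _ => Finset.mem_range.mpr x.val_lt) (by simp) (by simp)
    (fun x hx => ZMod.val_cast_of_lt (Finset.mem_range.mp hx)) (by simp)

theorem gaussSum_pairing_odd (k m : ℕ+) (j : ℤ) :
    gaussSum (Block.pairing ⟨k, .odd j⟩) m = ∑ x ∈ Finset.range (2 ^ (k : ℕ)),
      e ((2 * j + 1 : ℤ) * (x : ℚ) ^ 2 * 2 ^ (m : ℕ) / 2 ^ (k + 1 : ℕ)) := by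
  have hform : gaussSum (Block.pairing ⟨k, .odd j⟩) m = ∑ x : ZMod (2 ^ (k : ℕ)),
      phase m (toQmodZ _ (((2 * j + 1 : ℤ) : ZMod _) * x ^ 2)) := by
    refine Fintype.sum_equiv (Equiv.funUnique (Fin 1) _) _ _ fun x => ?_
    rw [Block.pairing, LinkingPairing.ofMatrix_form]
    congr 2
    simp only [dotProduct, Kind.rank, Finset.univ_unique, Fin.default_eq_zero, Matrix.mulVec,
      Kind.gramMod, Kind.gram, Int.coe_castRingHom, Matrix.map_apply, Matrix.of_apply,
      Matrix.cons_val', Matrix.cons_val_fin_one, Finset.sum_singleton, Equiv.funUnique_apply]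
    ring
  rw [hform, sum_zmod_eq_sum_range]
  refine Finset.sum_congr rfl fun x _ => ?_
  rw [← Int.cast_pow, ← Int.cast_mul, phase_toQmodZ]
  congr 1
  push_cast
  ring

theorem gaussSum_pairing_even (k m : ℕ+) (a c : ℤ) :
    gaussSum (Block.pairing ⟨k, .even a c⟩) m =
      ∑ x ∈ Finset.range (2 ^ (k : ℕ)), ∑ y ∈ Finset.range (2 ^ (k : ℕ)),
        e ((a * (x : ℚ) ^ 2 + x * y + c * (y : ℚ) ^ 2) * 2 ^ (m : ℕ) / 2 ^ (k : ℕ)) := by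
  have hform : gaussSum (Block.pairing ⟨k, .even a c⟩) m =
      ∑ p : ZMod (2 ^ (k : ℕ)) × ZMod (2 ^ (k : ℕ)),
        phase m (toQmodZ _ (((2 : ℤ) : ZMod _) *
          ((a : ZMod _) * p.1 ^ 2 + p.1 * p.2 + (c : ZMod _) * p.2 ^ 2))) := by
    refine Fintype.sum_equiv (finTwoArrowEquiv _) _ _ fun x => ?_
    rw [Block.pairing, LinkingPairing.ofMatrix_form]
    congr 2
    simp only [dotProduct, Kind.rank, Matrix.mulVec, Kind.gramMod, Kind.gram, Int.coe_castRingHom,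
      Matrix.map_apply, Matrix.of_apply, Matrix.cons_val', Matrix.cons_val_fin_one,
      Fin.sum_univ_two, Matrix.cons_val_zero, Matrix.cons_val_one, Int.cast_mul, Int.cast_ofNat,
      Int.cast_one, one_mul, finTwoArrowEquiv_apply, Equiv.toFun_as_coe, piFinTwoEquiv_apply]
    ring
  rw [hform, Fintype.sum_prod_type, sum_zmod_eq_sum_range]
  refine Finset.sum_congr rfl fun x _ => ?_
  rw [sum_zmod_eq_sum_range]
  refine Finset.sum_congr rfl fun y _ => ?_
  simp only [← Int.cast_pow, ← Int.cast_mul, ← Int.cast_add]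
  rw [phase_toQmodZ]
  congr 1
  push_cast
  ring

theorem gaussSum_pairing_odd_of_lt {k m : ℕ+} (h : k < m) (j : ℤ) :
    gaussSum (Block.pairing ⟨k, .odd j⟩) m = (2 ^ (k : ℕ) : ℝ) := by
  obtain ⟨d, hd⟩ := Nat.exists_eq_add_of_lt (PNat.coe_lt_coe k m |>.mpr h)
  have hterm (x : ℕ) :
      e ((2 * j + 1 : ℤ) * (x : ℚ) ^ 2 * 2 ^ (k + d + 1 : ℕ) / 2 ^ (k + 1 : ℕ)) = 1 := by
    rw [← e_intCast ((2 * j + 1) * x ^ 2 * 2 ^ d)]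
    congr 1; push_cast; field_simp; ring
  rw [gaussSum_pairing_odd, hd, Finset.sum_congr rfl fun x _ => hterm x]
  simp

theorem gaussSum_pairing_odd_of_eq_add {k m : ℕ+} {d : ℕ} (h : (k : ℕ) = m + d) (j : ℤ) :
    gaussSum (Block.pairing ⟨k, .odd j⟩) m =
      (2 ^ (m - 1 : ℕ) : ℝ) * oddGaussSum (d + 1) (2 * j + 1) := by
  obtain ⟨i, hi⟩ : ∃ i, (m : ℕ) = i + 1 := Nat.exists_eq_add_of_le' m.pos
  have hterm (x : ℕ) : (2 * j + 1 : ℤ) * (x : ℚ) ^ 2 * 2 ^ (i + 1) / 2 ^ (i + 1 + d + 1) =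
      (2 * j + 1 : ℤ) * (x : ℚ) ^ 2 / 2 ^ (d + 1) := by field_simp; ring
  rw [gaussSum_pairing_odd, h, hi, show 2 ^ (i + 1 + d) = 2 ^ (d + 1) * 2 ^ i by ring]
  simp only [hterm]
  rw [sum_range_mul_of_periodic (periodic_oddGaussSum_term _ _), nsmul_eq_mul, oddGaussSum]
  push_cast; rfl

theorem gaussSum_pairing_even_of_le {k m : ℕ+} (h : k ≤ m) (a c : ℤ) :
    gaussSum (Block.pairing ⟨k, .even a c⟩) m = (2 ^ (k : ℕ) * 2 ^ (k : ℕ) : ℝ) := by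
  obtain ⟨d, hd⟩ := Nat.exists_eq_add_of_le (PNat.coe_le_coe k m |>.mpr h)
  have hterm (x y : ℕ) : e ((a * (x : ℚ) ^ 2 + x * y + c * (y : ℚ) ^ 2) * 2 ^ (k + d : ℕ) /
      2 ^ (k : ℕ)) = 1 := by
    rw [← e_intCast ((a * x ^ 2 + x * y + c * y ^ 2) * 2 ^ d)]
    congr 1; push_cast; field_simp; ring
  rw [gaussSum_pairing_even, hd]
  simp [hterm]

theorem gaussSum_pairing_even_of_eq_add {k m : ℕ+} {d : ℕ} (h : (k : ℕ) = m + d) (a c : ℤ) :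
    gaussSum (Block.pairing ⟨k, .even a c⟩) m = ((2 ^ (m : ℕ)) ^ 2 : ℝ) * evenGaussSum d a c := by
  have hterm (x y : ℕ) : (a * (x : ℚ) ^ 2 + x * y + c * (y : ℚ) ^ 2) * 2 ^ (m : ℕ) /
      2 ^ (m + d : ℕ) = (a * (x : ℚ) ^ 2 + x * y + c * (y : ℚ) ^ 2) / 2 ^ d := by
    field_simp; ring
  rw [gaussSum_pairing_even, h, show 2 ^ (m + d : ℕ) = 2 ^ d * 2 ^ (m : ℕ) by ring]
  simp only [hterm, sum_range_two_pow_mul_evenGaussSum_term]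
  push_cast; rfl

namespace Block

theorem gaussSum_eq_zero {b : Block} (h : b.kind.IsOdd) : gaussSum b.pairing b.level = 0 := by
  obtain ⟨k, _ | _⟩ := b
  · rw [gaussSum_pairing_odd_of_eq_add (add_zero _).symm, oddGaussSum_one (odd_two_mul_add_one _),
      mul_zero]
  · exact h.elim

theorem hasPhase_gaussSum {b : Block} {m : ℕ+} (h : ¬(b.level = m ∧ b.kind.IsOdd)) :
    HasPhase (gaussSum b.pairing m) (b.sig m) := by
  obtain ⟨k, κ⟩ := b
  rcases le_or_gt k m with hle | hgt
  · rw [sig, if_pos (by exact_mod_cast hle)]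
    cases κ with
    | odd j =>
      rw [gaussSum_pairing_odd_of_lt (hle.lt_of_ne fun hkm => h ⟨hkm, trivial⟩)]
      exact .of_pos (by positivity)
    | even a c =>
      rw [gaussSum_pairing_even_of_le hle]
      exact .of_pos (by positivity)
  · obtain ⟨d, hd⟩ : ∃ d, (k : ℕ) = m + (d + 1) :=
      Nat.exists_eq_add_of_lt (PNat.coe_lt_coe m k |>.mpr hgt)
    have hgap : (k - m : ℤ) = (d + 1 : ℕ) := by omega
    rw [sig, if_neg (by exact_mod_cast hgt.not_ge)]
    cases κ with
    | odd j =>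
      rw [gaussSum_pairing_odd_of_eq_add hd]
      have hphase := hasPhase_oddGaussSum (odd_two_mul_add_one j) d
      simp only [hgap, Int.odd_coe_nat, Nat.odd_add_one, Nat.not_odd_iff_even]
      exact hphase.pos_mul (by positivity)
    | even a c =>
      rw [gaussSum_pairing_even_of_eq_add hd]
      have hphase := hasPhase_evenGaussSum a c (d + 1)
      simp only [ite_and] at hphase
      simp only [hgap, Int.odd_coe_nat, Kind.sigOddGap, Kind.sigEvenGap, ite_and]
      exact hphase.pos_mul (by positivity)

end Block

section Family

variable {ι : Type*} [Fintype ι] (B : ι → Block)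

/-- The invariant `ρ_m` of the orthogonal sum of the blocks `B i`. -/
def familyRank (m : ℕ+) : ℕ := ∑ i, if (B i).level = m then (B i).kind.rank else 0

open Classical in
/-- The invariant `σ_m` of the orthogonal sum of the blocks `B i`. -/
def familySig (m : ℕ+) : Z8bar :=
  if ∃ i, (B i).level = m ∧ (B i).kind.IsOdd then ⊤ else ((∑ i, (B i).sig m : ZMod 8) : Z8bar)

/-- The tableau of the orthogonal sum of the blocks `B i`. -/
def blockTableau : FullTableau := fun m => (familyRank B m, familySig B m)

/-- The linking pairing `l` is isometric to the orthogonal sum of the blocks `B i`. -/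
def IsSumOfBlocks {G : Type*} [AddCommGroup G] (l : LinkingPairing G) : Prop :=
  l.IsIsometric (.pi fun i => (B i).pairing)

variable {B}

theorem IsSumOfBlocks.sigma_eq {G : Type*} [AddCommGroup G] [Fintype G] {l : LinkingPairing G}
    (h : IsSumOfBlocks B l) (m : ℕ+) : sigma l m = familySig B m := by
  classical
  have hprod : gaussSum l m = ∏ i, gaussSum (B i).pairing m := by
    rw [LinkingPairing.IsIsometric.gaussSum_eq h, LinkingPairing.gaussSum_pi]
  rw [familySig]
  split_ifs with hodd
  · obtain ⟨i, rfl, hi⟩ := hodd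
    rw [sigma, if_pos]
    rw [hprod]
    exact Finset.prod_eq_zero (Finset.mem_univ i) (Block.gaussSum_eq_zero hi)
  · have hphase : HasPhase (gaussSum l m) (∑ i, (B i).sig m) := by
      rw [hprod]
      exact .prod _ fun i _ => Block.hasPhase_gaussSum fun hi => hodd ⟨i, hi⟩
    exact sigma_eq_coe l m _ hphase.ne_zero hphase.div_norm

end Family

/-! ### Decomposition into blocks -/

section Decomposition

variable {G : Type*} [AddCommGroup G]

theorem LinkingPairing.exists_form_ne_zero (l : LinkingPairing G) {x : G} (hx : x ≠ 0) :
    ∃ y, l.form x y ≠ 0 := by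
  by_contra! h
  exact hx (l.bijective_adjoint.1 (by rw [map_zero]; ext y; exact h y))

theorem LinkingPairing.exists_toQmodZ_eq_form (l : LinkingPairing G) {N : ℕ} [NeZero N] {x : G}
    (hx : N • x = 0) (y : G) : ∃ z : ℤ, toQmodZ N z = l.form x y :=
  exists_toQmodZ_intCast_eq (by rw [← AddMonoidHom.nsmul_apply, ← map_nsmul, hx, map_zero]; rfl)

theorem exists_two_pow_succ_nsmul_eq_zero [Nontrivial G] {n : ℕ} (hn : Nat.card G = 2 ^ n) :
    ∃ k, (∀ g : G, 2 ^ (k + 1) • g = 0) ∧ ∃ g : G, 2 ^ k • g ≠ 0 := by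
  classical
  have hex : ∃ k, ∀ g : G, 2 ^ k • g = 0 := ⟨n, fun g => hn ▸ card_nsmul_eq_zero'⟩
  obtain ⟨k, hk⟩ : ∃ k, Nat.find hex = k + 1 := by
    refine Nat.exists_eq_succ_of_ne_zero fun h => ?_
    obtain ⟨g, hg⟩ := exists_ne (0 : G)
    exact hg (by simpa [h] using Nat.find_spec hex g)
  exact ⟨k, hk ▸ Nat.find_spec hex, not_forall.mp (Nat.find_min hex (by omega))⟩

/-- The block `b` is isometric to an orthogonal summand of the linking pairing `l`. -/
def LinkingPairing.SplitsOff (l : LinkingPairing G) (b : Block) : Prop :=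
  ∃ (K : AddSubgroup G) (lK : LinkingPairing K), l.IsIsometric (b.pairing.prod lK)

variable {l : LinkingPairing G} {k : ℕ} {x y : G}

theorem LinkingPairing.exists_splitsOff_odd (hx : 2 ^ (k + 1) • x = 0)
    (hxx : 2 ^ k • l.form x x ≠ 0) : ∃ j, l.SplitsOff ⟨k.succPNat, .odd j⟩ := by
  obtain ⟨z, hz⟩ := l.exists_toQmodZ_eq_form hx x
  rw [← hz, Ne, two_pow_nsmul_toQmodZ_eq_zero_iff, Int.not_even_iff_odd] at hxx
  obtain ⟨j, rfl⟩ := hxx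
  refine ⟨j, l.exists_isIsometric_ofMatrix_prod _ _ (x := fun _ => x) (fun _ => hx) fun i i' => ?_⟩
  change Fin 1 at i i'
  fin_cases i; fin_cases i'
  exact hz.symm

theorem LinkingPairing.exists_splitsOff_even (hx : 2 ^ (k + 1) • x = 0) (hy : 2 ^ (k + 1) • y = 0)
    (hxx : 2 ^ k • l.form x x = 0) (hyy : 2 ^ k • l.form y y = 0) (hxy : 2 ^ k • l.form x y ≠ 0) :
    ∃ a c, l.SplitsOff ⟨k.succPNat, .even a c⟩ := by
  obtain ⟨z, hz⟩ := l.exists_toQmodZ_eq_form hx y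
  rw [← hz, Ne, two_pow_nsmul_toQmodZ_eq_zero_iff, Int.not_even_iff_odd] at hxy
  obtain ⟨u, hu⟩ := (isUnit_intCast_zmod_two_pow hxy (k + 1)).exists_left_inv
  obtain ⟨y', hy', hy'y', hxy'⟩ : ∃ y', 2 ^ (k + 1) • y' = 0 ∧ 2 ^ k • l.form y' y' = 0 ∧
      l.form x y' = toQmodZ (2 ^ (k + 1)) (1 : ℤ) := by
    refine ⟨u.val • y, by rw [smul_comm, hy, smul_zero], ?_, ?_⟩
    · rw [map_nsmul, map_nsmul, AddMonoidHom.nsmul_apply, smul_comm, smul_comm (2 ^ k), hyy,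
        smul_zero, smul_zero]
    · rw [map_nsmul, ← hz, ← toQmodZ_mul, hu, Int.cast_one]
  obtain ⟨w, hw⟩ := l.exists_toQmodZ_eq_form hx x
  obtain ⟨w', hw'⟩ := l.exists_toQmodZ_eq_form hy' y'
  rw [← hw, two_pow_nsmul_toQmodZ_eq_zero_iff, even_iff_exists_two_mul] at hxx
  rw [← hw', two_pow_nsmul_toQmodZ_eq_zero_iff, even_iff_exists_two_mul] at hy'y'
  obtain ⟨a, rfl⟩ := hxx
  obtain ⟨c, rfl⟩ := hy'y'
  refine ⟨a, c, l.exists_isIsometric_ofMatrix_prod _ _ (x := ![x, y']) (fun i => ?_)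
    fun i i' => ?_⟩
  · change Fin 2 at i
    fin_cases i
    exacts [hx, hy']
  · change Fin 2 at i i'
    fin_cases i <;> fin_cases i'
    exacts [hw.symm, hxy', (l.symm _ _).trans hxy', hw'.symm]

theorem LinkingPairing.exists_splitsOff [Nontrivial G] {n : ℕ} (hn : Nat.card G = 2 ^ n)
    (l : LinkingPairing G) : ∃ b, l.SplitsOff b := by
  obtain ⟨k, hkill, x, hx⟩ := exists_two_pow_succ_nsmul_eq_zero hn
  by_cases hodd : ∃ x, 2 ^ k • l.form x x ≠ 0
  · obtain ⟨x, hxx⟩ := hodd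
    obtain ⟨j, hj⟩ := exists_splitsOff_odd (hkill x) hxx
    exact ⟨_, hj⟩
  · push Not at hodd
    obtain ⟨y, hxy⟩ := l.exists_form_ne_zero hx
    rw [map_nsmul, AddMonoidHom.nsmul_apply] at hxy
    obtain ⟨a, c, hac⟩ := exists_splitsOff_even (hkill x) (hkill y) (hodd x) (hodd y) hxy
    exact ⟨_, hac⟩

theorem IsSumOfBlocks.option {ι : Type*} [Fintype ι] {B : ι → Block} {b : Block}
    {K : AddSubgroup G} {lK : LinkingPairing K} (hl : l.IsIsometric (b.pairing.prod lK))
    (hK : IsSumOfBlocks B lK) : IsSumOfBlocks (fun o : Option ι => o.elim b B) l := by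
  obtain ⟨f, hf⟩ := hl
  obtain ⟨g, hg⟩ := hK
  let consEquiv :
      (b.Carrier × ∀ i, (B i).Carrier) ≃+ ∀ o : Option ι, (o.elim b B : Block).Carrier :=
    .mk' (Equiv.piOptionEquivProd (β := fun o => (o.elim b B : Block).Carrier)).symm
      fun p q => by funext o; cases o <;> rfl
  refine ⟨(f.trans ((AddEquiv.refl _).prodCongr g)).trans consEquiv, fun x y => ?_⟩
  rw [← hf, LinkingPairing.prod_form, ← hg, LinkingPairing.pi_form, LinkingPairing.pi_form,
    Fintype.sum_option]
  rfl

theorem Block.one_lt_card_carrier (b : Block) : 1 < Nat.card b.Carrier := by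
  rw [Nat.card_fun, Nat.card_zmod, Nat.card_fin]
  refine Nat.one_lt_pow ?_ (Nat.one_lt_two_pow b.level.pos.ne')
  cases b.kind <;> simp

theorem exists_isSumOfBlocks {G : Type*} [AddCommGroup G] [Finite G] {n : ℕ}
    (hn : Nat.card G = 2 ^ n) (l : LinkingPairing G) :
    ∃ (ι : Type) (_ : Fintype ι) (B : ι → Block), IsSumOfBlocks B l := by
  induction n using Nat.strong_induction_on generalizing G with
  | _ n ih =>
    rcases subsingleton_or_nontrivial G with hG | hG
    · let _ : Unique G := uniqueOfSubsingleton 0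
      refine ⟨Empty, inferInstance, Empty.elim, .ofUnique, fun x y => ?_⟩
      rw [Subsingleton.elim x 0, map_zero, map_zero, map_zero]
      rfl
    · obtain ⟨b, K, lK, hl⟩ := l.exists_splitsOff hn
      have hcard : Nat.card G = Nat.card b.Carrier * Nat.card K := by
        rw [Nat.card_congr hl.choose.toEquiv, Nat.card_prod]
      obtain ⟨m, -, hK⟩ := (Nat.dvd_prime_pow Nat.prime_two).mp (hn ▸ Dvd.intro_left _ hcard.symm)
      have hmn : m < n := by
        rw [← Nat.pow_lt_pow_iff_right one_lt_two, ← hK, ← hn, hcard]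
        exact lt_mul_of_one_lt_left Nat.card_pos b.one_lt_card_carrier
      obtain ⟨ι, _, B, hB⟩ := ih m hmn hK lK
      exact ⟨Option ι, inferInstance, _, hB.option hl⟩

end Decomposition

/-! ### Ranks of homogeneous components -/

section TorsionCard

/-- The number of elements of `M` killed by `n`. -/
def torsionCard (M : Type*) [AddCommGroup M] (n : ℕ) : ℕ := Nat.card {x : M // n • x = 0}

variable {M M' : Type*} [AddCommGroup M] [AddCommGroup M']

theorem torsionCard_congr (f : M ≃+ M') (n : ℕ) : torsionCard M n = torsionCard M' n :=
  Nat.card_congr (f.toEquiv.subtypeEquiv fun x => by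
    change _ ↔ n • f x = 0
    rw [← map_nsmul, AddEquiv.map_eq_zero_iff])

theorem torsionCard_pos [Finite M] (n : ℕ) : 0 < torsionCard M n :=
  have : Nonempty {x : M // n • x = 0} := ⟨⟨0, smul_zero _⟩⟩
  Nat.card_pos

theorem torsionCard_pi {ι : Type*} [Fintype ι] (M : ι → Type*) [∀ i, AddCommGroup (M i)]
    (n : ℕ) : torsionCard (∀ i, M i) n = ∏ i, torsionCard (M i) n := by
  unfold torsionCard
  rw [← Nat.card_pi]
  exact Nat.card_congr ((Equiv.subtypeEquivRight fun x => funext_iff).trans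
    (Equiv.subtypePiEquivPi (p := fun i (y : M i) => n • y = 0)))

theorem torsionCard_zmod (m : ℕ) [NeZero m] (n : ℕ) : torsionCard (ZMod m) n = m.gcd n := by
  have hker := IsAddCyclic.card_nsmulAddMonoidHom_ker (ZMod m) n
  rw [Nat.card_zmod] at hker
  exact hker

theorem torsionCard_pi_zmod_two_pow (a i j : ℕ) :
    torsionCard (Fin a → ZMod (2 ^ i)) (2 ^ j) = 2 ^ (a * min i j) := by
  have hgcd : Nat.gcd (2 ^ i) (2 ^ j) = 2 ^ min i j := by
    rcases le_total i j with hij | hij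
    · rw [min_eq_left hij, Nat.gcd_eq_left (pow_dvd_pow 2 hij)]
    · rw [min_eq_right hij, Nat.gcd_eq_right (pow_dvd_pow 2 hij)]
  rw [torsionCard_pi, Fin.prod_const, torsionCard_zmod, hgcd, ← pow_mul, mul_comm]

-- The second difference of `j ↦ min i j` is `-1` at `j = i` and vanishes elsewhere.
theorem torsionCard_mul_torsionCard_of_equiv {a i k : ℕ} (hk : 0 < k)
    (f : M ≃+ (Fin a → ZMod (2 ^ i))) :
    torsionCard M (2 ^ (k + 1)) * torsionCard M (2 ^ (k - 1)) * (if i = k then 2 ^ a else 1) =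
      torsionCard M (2 ^ k) ^ 2 := by
  have hmin : min i (k + 1) + min i (k - 1) + (if i = k then 1 else 0) = min i k * 2 := by
    split_ifs <;> omega
  have hpow : (if i = k then 2 ^ a else 1) = 2 ^ (a * if i = k then 1 else 0) := by
    split_ifs <;> simp
  simp only [torsionCard_congr f, torsionCard_pi_zmod_two_pow]
  rw [hpow, ← pow_add, ← pow_add, ← pow_mul, ← mul_add, ← mul_add, hmin, mul_assoc]

variable {ι : Type*} [DecidableEq ι] {H : ι → AddSubgroup M} {S : Finset ι}

/-- The projection of an internal direct sum onto finitely many components which contain all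
nonzero ones. -/
def equivPiOfIsInternal (hH : DirectSum.IsInternal H) (hS : ∀ k ∉ S, H k = ⊥) :
    M ≃+ ∀ k : S, H k :=
  let restrict : (DirectSum ι fun k => H k) →+ ∀ k : S, H k :=
    .mk' (fun x k => x k) fun _ _ => rfl
  have hinj : Function.Injective restrict := by
    rw [injective_iff_map_eq_zero]
    intro x hx
    ext k
    by_cases hk : k ∈ S
    · exact congrArg Subtype.val (congrFun hx ⟨k, hk⟩)
    · exact AddSubgroup.mem_bot.mp ((hS k hk).le (x k).2)
  have hsurj : Function.Surjective restrict := fun y =>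
    ⟨DirectSum.mk (fun k => H k) S fun k => y k, funext fun k =>
      DirectSum.mk_apply_of_mem (β := fun k => H k) (f := fun k => y k) k.2⟩
  (AddEquiv.ofBijective (DirectSum.coeAddMonoidHom H) hH).symm.trans
    (.ofBijective restrict ⟨hinj, hsurj⟩)

theorem torsionCard_eq_prod_of_isInternal (hH : DirectSum.IsInternal H) (hS : ∀ k ∉ S, H k = ⊥)
    (n : ℕ) : torsionCard M n = ∏ k ∈ S, torsionCard (H k) n := by
  rw [torsionCard_congr (equivPiOfIsInternal hH hS), torsionCard_pi,
    Finset.prod_coe_sort S fun k => torsionCard (H k) n]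

end TorsionCard

namespace IsHomogeneousDecomposition

variable {G : Type*} [AddCommGroup G] [Finite G] {l l' : LinkingPairing G}
  {H H' : ℕ+ → AddSubgroup G} {k : ℕ+} {a b : ℕ}

theorem torsionCard_mul_torsionCard (hH : IsHomogeneousDecomposition l H)
    (ha : Nonempty (H k ≃+ (Fin a → ZMod (2 ^ (k : ℕ))))) :
    torsionCard G (2 ^ (k + 1 : ℕ)) * torsionCard G (2 ^ (k - 1 : ℕ)) * 2 ^ a =
      torsionCard G (2 ^ (k : ℕ)) ^ 2 := by
  have hfin : {i | H i ≠ ⊥}.Finite :=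
    WellFoundedGT.finite_ne_bot_of_iSupIndep hH.isInternal.addSubgroup_iSupIndep
  let S := insert k hfin.toFinset
  have hS (i : ℕ+) (hi : i ∉ S) : H i = ⊥ := by
    by_contra hne
    exact hi (Finset.mem_insert_of_mem (hfin.mem_toFinset.mpr hne))
  have hcomponent (i : ℕ+) : torsionCard (H i) (2 ^ (k + 1 : ℕ)) *
      torsionCard (H i) (2 ^ (k - 1 : ℕ)) * (if i = k then 2 ^ a else 1) =
        torsionCard (H i) (2 ^ (k : ℕ)) ^ 2 := by
    by_cases hik : i = k
    · subst hik
      obtain ⟨f⟩ := ha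
      simpa using torsionCard_mul_torsionCard_of_equiv i.pos f
    · obtain ⟨c, ⟨f⟩⟩ := hH.free i
      simpa [hik] using torsionCard_mul_torsionCard_of_equiv k.pos f
  have hprod : 2 ^ a = ∏ i ∈ S, if i = k then 2 ^ a else 1 := by
    rw [Finset.prod_ite_eq' S k, if_pos (Finset.mem_insert_self _ _)]
  simp only [torsionCard_eq_prod_of_isInternal hH.isInternal hS]
  rw [hprod, ← Finset.prod_mul_distrib, ← Finset.prod_mul_distrib, ← Finset.prod_pow]
  exact Finset.prod_congr rfl fun i _ => hcomponent i

theorem rank_unique (hH : IsHomogeneousDecomposition l H) (hH' : IsHomogeneousDecomposition l' H')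
    (ha : Nonempty (H k ≃+ (Fin a → ZMod (2 ^ (k : ℕ)))))
    (hb : Nonempty (H' k ≃+ (Fin b → ZMod (2 ^ (k : ℕ))))) : a = b :=
  Nat.pow_right_injective le_rfl <|
    Nat.eq_of_mul_eq_mul_left (Nat.mul_pos (torsionCard_pos _) (torsionCard_pos _)) <|
      (hH.torsionCard_mul_torsionCard ha).trans (hH'.torsionCard_mul_torsionCard hb).symm

theorem rho_eq (hH : IsHomogeneousDecomposition l H)
    (ha : Nonempty (H k ≃+ (Fin a → ZMod (2 ^ (k : ℕ))))) : rho l k = a := by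
  obtain ⟨H', hH', ha'⟩ := Classical.epsilon_spec
    (p := fun n : ℕ => ∃ H : ℕ+ → AddSubgroup G,
      IsHomogeneousDecomposition l H ∧ Nonempty (H k ≃+ (Fin n → ZMod (2 ^ (k : ℕ)))))
    ⟨a, H, hH, ha⟩
  exact hH'.rank_unique hH ha' ha

end IsHomogeneousDecomposition

section HomogeneousPart

variable {G : Type*} [AddCommGroup G] {ι : Type*} (B : ι → Block)
  (f : G ≃+ ∀ i, (B i).Carrier) (k : ℕ+)

/-- The part of level `k` of a sum of blocks. -/
def homogeneousPart : AddSubgroup G where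
  carrier := {g | ∀ i, (B i).level ≠ k → f g i = 0}
  zero_mem' i _ := by rw [map_zero]; rfl
  add_mem' {a b} ha hb i hi := by rw [map_add, Pi.add_apply, ha i hi, hb i hi, add_zero]
  neg_mem' {a} ha i hi := by rw [map_neg, Pi.neg_apply, ha i hi, neg_zero]

theorem apply_coeAddMonoidHom_homogeneousPart
    (x : DirectSum ℕ+ fun k => homogeneousPart B f k) (i : ι) :
    f (DirectSum.coeAddMonoidHom (homogeneousPart B f) x) i = f (x (B i).level : G) i := by
  induction x using DirectSum.induction_on with
  | zero => simp
  | of k y =>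
    rw [DirectSum.coeAddMonoidHom_of]
    by_cases h : (B i).level = k
    · subst h
      rw [DirectSum.of_eq_same]
    · rw [DirectSum.of_eq_of_ne _ _ _ h, y.2 i h]
      simp
  | add x y hx hy =>
    rw [map_add, map_add, Pi.add_apply, hx, hy]
    simp

theorem isInternal_homogeneousPart [Finite ι] : DirectSum.IsInternal (homogeneousPart B f) := by
  classical
  have := Fintype.ofFinite ι
  constructor
  · rw [injective_iff_map_eq_zero]
    intro x hx
    ext k
    suffices f (x k : G) = 0 by simpa using this
    funext i
    by_cases h : (B i).level = k
    · subst h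
      rw [← apply_coeAddMonoidHom_homogeneousPart, hx, map_zero]
    · exact (x k).2 i h
  · intro g
    have hsum : g = ∑ i, f.symm (Pi.single i (f g i)) := by
      rw [← map_sum, Finset.univ_sum_single, AddEquiv.symm_apply_apply]
    rw [← AddMonoidHom.mem_range, hsum]
    refine AddSubgroup.sum_mem _ fun i _ => ⟨DirectSum.of _ (B i).level
      ⟨f.symm (Pi.single i (f g i)), fun j hj => ?_⟩, DirectSum.coeAddMonoidHom_of _ _ _⟩
    rw [AddEquiv.apply_symm_apply, Pi.single_eq_of_ne]
    exact fun h => hj (congrArg (fun i => (B i).level) h)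

open Classical in
/-- The part of level `k` of a sum of blocks is the sum of the blocks of level `k`. -/
def homogeneousPartEquivPi :
    homogeneousPart B f k ≃+ ∀ i : {i // (B i).level = k}, (B i).Carrier where
  toFun g i := f (g : G) i
  invFun x := ⟨f.symm fun i => if h : (B i).level = k then x ⟨i, h⟩ else 0, fun i hi => by
    rw [AddEquiv.apply_symm_apply, dif_neg hi]⟩
  left_inv g := by
    ext
    rw [AddEquiv.symm_apply_eq]
    funext i
    split_ifs with h
    · rfl
    · exact (g.2 i h).symm
  right_inv x := by
    funext i
    dsimp only
    rw [AddEquiv.apply_symm_apply, dif_pos i.2]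
  map_add' a b := by
    funext i
    simp

theorem nonempty_homogeneousPart_equiv [Fintype ι] :
    Nonempty (homogeneousPart B f k ≃+ (Fin (familyRank B k) → ZMod (2 ^ (k : ℕ)))) := by
  classical
  let J := {i // (B i).level = k}
  let changeModulus : (∀ i : J, (B i).Carrier) ≃+
      ∀ i : J, (Fin (B i).kind.rank → ZMod (2 ^ (k : ℕ))) :=
    .piCongrRight fun i => .piCongrRight fun _ => (ZMod.ringEquivCongr (by rw [i.2])).toAddEquiv
  let uncurry : (∀ i : J, (Fin (B i).kind.rank → ZMod (2 ^ (k : ℕ)))) ≃+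
      ((Σ i : J, Fin (B i).kind.rank) → ZMod (2 ^ (k : ℕ))) :=
    (LinearEquiv.piCurry ℤ fun (i : J) (_ : Fin (B i).kind.rank) =>
      ZMod (2 ^ (k : ℕ))).symm.toAddEquiv
  have hcard : Fintype.card (Σ i : J, Fin (B i).kind.rank) = familyRank B k := by
    simp only [Fintype.card_sigma, Fintype.card_fin]
    rw [familyRank, ← Finset.sum_filter,
      Finset.sum_subtype (p := fun i => (B i).level = k) _ (by simp)]
  let reindex : ((Σ i : J, Fin (B i).kind.rank) → ZMod (2 ^ (k : ℕ))) ≃+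
      (Fin (familyRank B k) → ZMod (2 ^ (k : ℕ))) :=
    (LinearEquiv.funCongrLeft ℤ _ (Fintype.equivFinOfCardEq hcard).symm).toAddEquiv
  exact ⟨(homogeneousPartEquivPi B f k).trans (changeModulus.trans (uncurry.trans reindex))⟩

variable {B}

theorem IsSumOfBlocks.rho_eq [Fintype ι] [Finite G] {l : LinkingPairing G}
    (h : IsSumOfBlocks B l) (m : ℕ+) : rho l m = familyRank B m := by
  obtain ⟨f, hf⟩ := h
  have hH : IsHomogeneousDecomposition l (homogeneousPart B f) :=
    { isInternal := isInternal_homogeneousPart B f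
      orthogonal i j hij x hx y hy := by
        rw [← hf, LinkingPairing.pi_form]
        refine Finset.sum_eq_zero fun a _ => ?_
        by_cases ha : (B a).level = i
        · rw [hy a (ha ▸ hij), map_zero]
        · rw [hx a ha, map_zero, AddMonoidHom.zero_apply]
      free k := ⟨_, nonempty_homogeneousPart_equiv B f k⟩ }
  exact hH.rho_eq (nonempty_homogeneousPart_equiv B f m)

end HomogeneousPart

theorem admissible_blockTableau {ι : Type} [Fintype ι] (B : ι → Block) :
    (blockTableau B).Admissible := by
  classical
  have hB : IsSumOfBlocks B (.pi fun i => (B i).pairing) := ⟨.refl _, fun _ _ => rfl⟩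
  refine ⟨∀ i, (B i).Carrier, inferInstance, inferInstance, .pi fun i => (B i).pairing,
    ⟨∑ i, (B i).level * (B i).kind.rank, ?_⟩, fun m => ⟨(hB.rho_eq m).symm, (hB.sigma_eq m).symm⟩⟩
  simp only [Nat.card_pi, Nat.card_zmod, Finset.prod_pow_eq_pow_sum, Fin.sum_const, smul_eq_mul,
    mul_comm]

theorem admissible_iff_exists_blockTableau (T : FullTableau) :
    T.Admissible ↔ ∃ (ι : Type) (_ : Fintype ι) (B : ι → Block), T = blockTableau B := by
  constructor
  · rintro ⟨G, _, _, l, ⟨n, hn⟩, hT⟩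
    obtain ⟨ι, _, B, hB⟩ := exists_isSumOfBlocks hn l
    exact ⟨ι, _, B, funext fun m =>
      Prod.ext ((hT m).1.trans (hB.rho_eq m)) ((hT m).2.trans (hB.sigma_eq m))⟩
  · rintro ⟨ι, _, B, rfl⟩
    exact admissible_blockTableau B

/-! ### Necessity of the conditions -/

theorem congrMod_iff {d c : ℕ} (h : d * c = 8) (a : Z8bar) (n : ℕ) :
    CongrMod d a n ↔ ∃ x : ZMod 8, a = x ∧ (c * x : ZMod 8) = c * n := by
  have hc : (c : ℤ) ≠ 0 := by intro hc; rw [Int.natCast_eq_zero.mp hc] at h; omega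
  refine exists_congr fun x => and_congr_right fun _ => ?_
  obtain ⟨z, rfl⟩ := ZMod.intCast_surjective x
  rw [ZMod.cast_intCast ⟨c, h.symm⟩, ← Int.cast_natCast (R := ZMod d) n,
    ← Int.cast_natCast (R := ZMod 8) n, ← Int.cast_natCast (R := ZMod 8) c, ← Int.cast_mul,
    ← Int.cast_mul, ZMod.intCast_eq_intCast_iff_dvd_sub,
    ZMod.intCast_eq_intCast_iff_dvd_sub, ← mul_sub, ← h, Nat.cast_mul, mul_comm (d : ℤ),
    mul_dvd_mul_iff_left hc]

namespace Kind

variable {κ : Kind}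

theorem rank_of_isOdd (h : κ.IsOdd) : κ.rank = 1 := by
  cases κ with
  | odd j => rfl
  | even a c => exact h.elim

theorem rank_of_not_isOdd (h : ¬ κ.IsOdd) : κ.rank = 2 := by
  cases κ with
  | odd j => exact (h trivial).elim
  | even a c => rfl

theorem rank_pos (κ : Kind) : 0 < κ.rank := by cases κ <;> simp

theorem sigOddGap_of_isOdd (h : κ.IsOdd) : κ.sigOddGap = 1 ∨ κ.sigOddGap = -1 := by
  cases κ with
  | even a c => exact h.elim
  | odd j =>
    obtain hj | hj : (2 * j + 1) % 4 = 1 ∨ (2 * j + 1) % 4 = 3 := by omega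
    · left; rw [sigOddGap, ZMod.χ₄_int_one_mod_four hj]; rfl
    · right; rw [sigOddGap, ZMod.χ₄_int_three_mod_four hj]; rfl

theorem sigOddGap_of_not_isOdd (h : ¬ κ.IsOdd) : κ.sigOddGap = 0 ∨ κ.sigOddGap = 4 := by
  cases κ with
  | odd j => exact (h trivial).elim
  | even a c => rw [sigOddGap]; split_ifs <;> simp

theorem sigEvenGap_of_not_isOdd (h : ¬ κ.IsOdd) : κ.sigEvenGap = 0 := by
  cases κ with
  | odd j => exact (h trivial).elim
  | even a c => rfl

theorem two_mul_sigEvenGap (κ : Kind) : 2 * κ.sigEvenGap = 2 * κ.sigOddGap := by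
  cases κ with
  | even a c => rw [sigOddGap, sigEvenGap]; split_ifs <;> decide
  | odd j =>
    rw [sigEvenGap, ← ZMod.intCast_mod, sigOddGap]
    obtain ⟨hj, hj'⟩ | ⟨hj, hj'⟩ :
        (2 * j + 1) % 4 = 1 ∧ ((2 * j + 1) % 8 = 1 ∨ (2 * j + 1) % 8 = 5) ∨
          (2 * j + 1) % 4 = 3 ∧ ((2 * j + 1) % 8 = 3 ∨ (2 * j + 1) % 8 = 7) := by omega
    · rw [ZMod.χ₄_int_one_mod_four hj]
      rcases hj' with hj' | hj'
      · rw [Nat.cast_ofNat, hj']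
      · rw [Nat.cast_ofNat, hj']; decide
    · rw [ZMod.χ₄_int_three_mod_four hj]
      rcases hj' with hj' | hj' <;> (rw [Nat.cast_ofNat, hj']; decide)

theorem four_mul_sigOddGap (κ : Kind) : 4 * κ.sigOddGap = 4 * (κ.rank : ZMod 8) := by
  by_cases h : κ.IsOdd
  · rw [rank_of_isOdd h]
    rcases sigOddGap_of_isOdd h with hs | hs <;> rw [hs] <;> decide
  · rw [rank_of_not_isOdd h]
    rcases sigOddGap_of_not_isOdd h with hs | hs <;> rw [hs] <;> decide

theorem exists_sum_sigOddGap_eq {ι : Type*} {κ : ι → Kind} {s : Finset ι}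
    (hs : ∀ i ∈ s, (κ i).IsOdd) : ∃ p ≤ ∑ i ∈ s, (κ i).rank,
      ∑ i ∈ s, (κ i).sigOddGap = ((∑ i ∈ s, (κ i).rank : ℕ) : ZMod 8) - 2 * p := by
  classical
  induction s using Finset.induction_on with
  | empty => exact ⟨0, by simp⟩
  | insert a s ha ih =>
    obtain ⟨p, hp, hsum⟩ := ih fun i hi => hs i (Finset.mem_insert_of_mem hi)
    have haodd := hs a (Finset.mem_insert_self a s)
    rw [Finset.sum_insert ha, Finset.sum_insert ha, hsum, rank_of_isOdd haodd]
    rcases sigOddGap_of_isOdd haodd with hsig | hsig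
    · exact ⟨p, by omega, by rw [hsig]; push_cast; ring⟩
    · exact ⟨p + 1, by omega, by rw [hsig]; push_cast; ring⟩

end Kind

namespace Block

variable {b : Block} {m n : ℤ}

theorem sig_of_le (h : b.level ≤ m) : b.sig m = 0 := if_pos h

theorem sig_of_odd (h : m < b.level) (hodd : Odd (b.level - m : ℤ)) :
    b.sig m = b.kind.sigOddGap := by
  rw [sig, if_neg h.not_ge, if_pos hodd]

theorem sig_of_even (h : m < b.level) (heven : Even (b.level - m : ℤ)) :
    b.sig m = b.kind.sigEvenGap := by
  rw [sig, if_neg h.not_ge, if_neg (Int.not_odd_iff_even.mpr heven)]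

theorem two_mul_sig (h : m < b.level) : 2 * b.sig m = 2 * b.kind.sigOddGap := by
  rcases Int.even_or_odd (b.level - m) with heven | hodd
  · rw [sig_of_even h heven, b.kind.two_mul_sigEvenGap]
  · rw [sig_of_odd h hodd]

theorem two_mul_sig_of_not_isOdd (h : ¬ b.kind.IsOdd) (m : ℤ) : 2 * b.sig m = 0 := by
  rcases le_or_gt (b.level : ℤ) m with hle | hlt
  · rw [sig_of_le hle, mul_zero]
  · rw [two_mul_sig hlt]
    rcases Kind.sigOddGap_of_not_isOdd h with hs | hs <;> rw [hs] <;> decide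

theorem four_mul_sig (b : Block) (m : ℤ) :
    4 * b.sig m = if m < b.level then 4 * (b.kind.rank : ZMod 8) else 0 := by
  split_ifs with h
  · linear_combination 2 * two_mul_sig h + b.kind.four_mul_sigOddGap
  · rw [sig_of_le (not_lt.mp h), mul_zero]

theorem two_mul_sig_add_sig_add_one (h : b.level = m + 1 → ¬ b.kind.IsOdd) :
    2 * (b.sig m + b.sig (m + 1)) =
      if m + 1 < b.level then 4 * (b.kind.rank : ZMod 8) else 0 := by
  rcases lt_trichotomy (b.level : ℤ) (m + 1) with hlt | heq | hgt
  · rw [if_neg hlt.not_gt, sig_of_le (Int.lt_add_one_iff.mp hlt), sig_of_le hlt.le, add_zero,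
      mul_zero]
  · rw [if_neg heq.not_gt, mul_add, two_mul_sig_of_not_isOdd (h heq),
      two_mul_sig_of_not_isOdd (h heq), add_zero]
  · rw [if_pos hgt]
    linear_combination two_mul_sig hgt + two_mul_sig ((lt_add_one m).trans hgt) +
      b.kind.four_mul_sigOddGap

theorem sig_sub_sig (hmn : m ≤ n) (heven : Even (n - m)) (hn : b.level = n → ¬ b.kind.IsOdd) :
    b.sig m - b.sig n = if m < b.level ∧ b.level < n then b.sig m else 0 := by
  rcases le_or_gt (b.level : ℤ) m with hm | hm
  · rw [if_neg fun h => h.1.not_ge hm, sig_of_le hm, sig_of_le (hm.trans hmn), sub_zero]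
  rcases lt_trichotomy (b.level : ℤ) n with hlt | rfl | hgt
  · rw [if_pos ⟨hm, hlt⟩, sig_of_le hlt.le, sub_zero]
  · rw [if_neg fun h => h.2.false, sig_of_le le_rfl, sig_of_even hm heven,
      Kind.sigEvenGap_of_not_isOdd (hn rfl), sub_zero]
  · rw [if_neg fun h => h.2.not_gt hgt, sub_eq_zero]
    have hgap : (b.level - n : ℤ) = b.level - m - (n - m) := by ring
    rcases Int.even_or_odd (b.level - m) with he | ho
    · rw [sig_of_even hm he, sig_of_even hgt (hgap ▸ he.sub heven)]
    · rw [sig_of_odd hm ho, sig_of_odd hgt (hgap ▸ ho.sub_even heven)]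

end Block

/-- The sum `∑_{j ≥ k} r(j)` of the formal ranks from `k` on. -/
def FullTableau.tailRank (T : FullTableau) (k : ℕ+) : ℕ := ∑ᶠ (j : ℕ+) (_ : k ≤ j), T.r j

section Necessity

variable {ι : Type*} [Fintype ι] {B : ι → Block} {m n : ℕ+}

theorem tailRank_blockTableau (B : ι → Block) (k : ℕ+) :
    (blockTableau B).tailRank k = ∑ i, if k ≤ (B i).level then (B i).kind.rank else 0 := by
  classical
  have hterm (j : ℕ+) : (∑ᶠ _ : k ≤ j, (blockTableau B).r j) =
      ∑ i, if j = (B i).level then (if k ≤ j then (B i).kind.rank else 0) else 0 := by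
    rw [finsum_eq_if]
    split_ifs
    · exact Finset.sum_congr rfl fun i _ => if_congr eq_comm rfl rfl
    · simp
  simp only [FullTableau.tailRank, hterm]
  rw [finsum_sum_comm _ _ fun i _ => (Set.finite_singleton (B i).level).subset fun j hj => by
    by_contra hne; exact hj (if_neg hne)]
  refine Finset.sum_congr rfl fun i _ => ?_
  rw [finsum_eq_single _ (B i).level fun j hj => if_neg hj, if_pos rfl]

theorem not_isOdd_of_isRegular (h : (blockTableau B).IsRegular m) {i : ι}
    (hi : (B i).level = m) : ¬ (B i).kind.IsOdd := by
  intro hodd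
  rcases h with h | h
  · have hi0 := Finset.sum_eq_zero_iff.mp h i (Finset.mem_univ i)
    rw [if_pos hi] at hi0
    exact (B i).kind.rank_pos.ne' hi0
  · exact h (if_pos ⟨i, hi, hodd⟩)

theorem blockTableau_s_of_isRegular (h : (blockTableau B).IsRegular m) :
    (blockTableau B).s m = ((∑ i, (B i).sig m : ZMod 8) : Z8bar) :=
  if_neg fun ⟨_, hi, hodd⟩ => not_isOdd_of_isRegular h hi hodd

theorem cond1_blockTableau (B : ι → Block) : (blockTableau B).Cond1 := by
  intro m hm
  refine Finset.even_sum _ fun i _ => ?_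
  split_ifs with hi
  · rw [Kind.rank_of_not_isOdd (not_isOdd_of_isRegular hm hi)]
    exact even_two
  · exact Even.zero

theorem cond2_blockTableau (B : ι → Block) : (blockTableau B).Cond2 := by
  intro m hm
  refine (congrMod_iff (c := 4) rfl _ _).mpr ⟨_, blockTableau_s_of_isRegular hm, ?_⟩
  change _ = ((4 : ℕ) : ZMod 8) * ((blockTableau B).tailRank (m + 1) : ZMod 8)
  rw [tailRank_blockTableau, Nat.cast_sum, Finset.mul_sum, Finset.mul_sum]
  refine Finset.sum_congr rfl fun i _ => ?_
  simp only [Nat.cast_ofNat, Block.four_mul_sig, PNat.add_one_le_iff, Nat.cast_lt, PNat.coe_lt_coe,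
    Nat.cast_ite, mul_ite, Nat.cast_zero, mul_zero]

theorem cond3_blockTableau (B : ι → Block) : (blockTableau B).Cond3 := by
  intro m hm hm'
  have hs : (blockTableau B).s m + (blockTableau B).s (m + 1) =
      ((∑ i, (B i).sig m + ∑ i, (B i).sig (m + 1) : ZMod 8) : Z8bar) := by
    rw [blockTableau_s_of_isRegular hm, blockTableau_s_of_isRegular hm', WithTop.coe_add]
    push_cast; rfl
  refine (congrMod_iff (c := 2) rfl _ _).mpr ⟨_, hs, ?_⟩
  change _ = ((2 : ℕ) : ZMod 8) * ((2 * (blockTableau B).tailRank (m + 1 + 1) : ℕ) : ZMod 8)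
  rw [tailRank_blockTableau, ← Finset.sum_add_distrib, Nat.cast_mul, ← mul_assoc, Nat.cast_sum,
    Finset.mul_sum, Finset.mul_sum]
  refine Finset.sum_congr rfl fun i _ => ?_
  have hodd (hi : ((B i).level : ℤ) = m + 1) : ¬ (B i).kind.IsOdd :=
    not_isOdd_of_isRegular hm' (PNat.coe_injective (by exact_mod_cast hi))
  have hlt : (m + 1 : ℤ) < (B i).level ↔ m + 1 + 1 ≤ (B i).level := by
    rw [PNat.add_one_le_iff, ← PNat.coe_lt_coe, PNat.add_coe]; norm_cast
  rw [Nat.cast_ofNat, Block.two_mul_sig_add_sig_add_one hodd, Nat.cast_ite, Nat.cast_zero, mul_ite,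
    mul_zero, if_congr hlt rfl rfl]
  norm_num

theorem sum_sig_sub_sum_sig (hmn : m ≤ n) (heven : Even (n - m : ℤ))
    (hn : (blockTableau B).IsRegular n) :
    ∑ i, (B i).sig m - ∑ i, (B i).sig n =
      ∑ i with m < (B i).level ∧ (B i).level < n, (B i).sig m := by
  rw [← Finset.sum_sub_distrib, Finset.sum_filter]
  refine Finset.sum_congr rfl fun i _ => ?_
  rw [Block.sig_sub_sig (by exact_mod_cast hmn) heven fun hi =>
    not_isOdd_of_isRegular hn (PNat.coe_injective (by exact_mod_cast hi))]
  simp only [Nat.cast_lt, PNat.coe_lt_coe]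

theorem diffMem_blockTableau (hm : (blockTableau B).IsRegular m)
    (hn : (blockTableau B).IsRegular n) (hmn : m ≤ n) (heven : Even (n - m : ℤ))
    {D : Set (ZMod 8)} (h : ∑ i with m < (B i).level ∧ (B i).level < n, (B i).sig m ∈ D) :
    DiffMem ((blockTableau B).s m) ((blockTableau B).s n) D :=
  ⟨_, _, blockTableau_s_of_isRegular hm, blockTableau_s_of_isRegular hn,
    by rwa [sum_sig_sub_sum_sig hmn heven hn]⟩

theorem sum_sig_between_of_r_eq_zero
    (h : ∀ k, m < k → k < n → (blockTableau B).r k = 0) :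
    ∑ i with m < (B i).level ∧ (B i).level < n, (B i).sig m = 0 := by
  refine Finset.sum_eq_zero fun i hi => ?_
  obtain ⟨-, hmi, hin⟩ := Finset.mem_filter.mp hi
  have hi0 := Finset.sum_eq_zero_iff.mp (h _ hmi hin) i (Finset.mem_univ i)
  rw [if_pos rfl] at hi0
  exact absurd hi0 (B i).kind.rank_pos.ne'

theorem sum_sig_between_of_isRegular
    (h : ∀ k, m < k → k < n → (blockTableau B).IsRegular k) :
    ∑ i with m < (B i).level ∧ (B i).level < n, (B i).sig m ∈ ({0, 4} : Set (ZMod 8)) := by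
  have hdouble : 2 * ∑ i with m < (B i).level ∧ (B i).level < n, (B i).sig m = 0 := by
    rw [Finset.mul_sum]
    refine Finset.sum_eq_zero fun i hi => ?_
    obtain ⟨-, hmi, hin⟩ := Finset.mem_filter.mp hi
    exact Block.two_mul_sig_of_not_isOdd (not_isOdd_of_isRegular (h _ hmi hin) rfl) m
  have hzero_or_four : ∀ x : ZMod 8, 2 * x = 0 → x = 0 ∨ x = 4 := by decide
  exact hzero_or_four _ hdouble

theorem forall_isOdd_of_familyRank_le_two (hr : familyRank B m ≤ 2)
    (hs : familySig B m = ⊤) {i : ι} (hi : (B i).level = m) : (B i).kind.IsOdd := by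
  classical
  obtain ⟨j, hj, hjodd⟩ : ∃ j, (B j).level = m ∧ (B j).kind.IsOdd := by
    by_contra hnone
    exact WithTop.coe_ne_top ((if_neg hnone).symm.trans hs)
  by_contra hieven
  have hij : i ≠ j := fun h => hieven (h ▸ hjodd)
  have hle : (B i).kind.rank + (B j).kind.rank ≤ familyRank B m := by
    have hpair := Finset.sum_le_sum_of_subset (Finset.subset_univ {i, j})
      (f := fun i => if (B i).level = m then (B i).kind.rank else 0)
    rwa [Finset.sum_pair hij, if_pos hi, if_pos hj] at hpair
  rw [Kind.rank_of_not_isOdd hieven, Kind.rank_of_isOdd hjodd] at hle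
  omega

theorem exists_sum_sig_between_eq {r : ℕ} (hr : r ≤ 2) (h : blockTableau B (m + 1) = (r, ⊤)) :
    ∃ p ≤ r, ∑ i with m < (B i).level ∧ (B i).level < m + 1 + 1, (B i).sig m =
      (r : ZMod 8) - 2 * p := by
  obtain ⟨hrank, htop⟩ := Prod.ext_iff.mp h
  have hfilter (i : ι) :
      m < (B i).level ∧ (B i).level < m + 1 + 1 ↔ (B i).level = m + 1 := by
    rw [PNat.lt_add_one_iff, ← PNat.add_one_le_iff, le_antisymm_iff, and_comm]
  have hsig (i : ι) (hi : (B i).level = m + 1) : (B i).sig m = (B i).kind.sigOddGap :=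
    Block.sig_of_odd (by rw [hi]; push_cast; omega) (by rw [hi]; push_cast; simp)
  have hsum : ∑ i with (B i).level = m + 1, (B i).kind.rank = r :=
    (Finset.sum_filter ..).trans hrank
  have hodd : ∀ i ∈ ({i | (B i).level = m + 1} : Finset ι), (B i).kind.IsOdd := fun i hi =>
    forall_isOdd_of_familyRank_le_two (hrank.trans_le hr) htop (Finset.mem_filter.mp hi).2
  obtain ⟨p, hp, hpsum⟩ := Kind.exists_sum_sigOddGap_eq hodd
  rw [hsum] at hp hpsum
  refine ⟨p, hp, ?_⟩
  rw [Finset.filter_congr fun i _ => hfilter i, ← hpsum]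
  exact Finset.sum_congr rfl fun i hi => hsig i (Finset.mem_filter.mp hi).2

theorem eq_Icc_of_isLeast_of_isGreatest {α : Type*} [PartialOrder α] {I : Set α}
    (hI : I.OrdConnected) {a b : α} (ha : IsLeast I a) (hb : IsGreatest I b) :
    I = Set.Icc a b :=
  Set.Subset.antisymm (fun _ hx => ⟨ha.2 hx, hb.2 hx⟩) (hI.out ha.1 hb.1)

theorem ncard_Icc_add_one (m b : ℕ+) : (Set.Icc (m + 1) b).ncard = (b - m : ℕ) := by
  rw [← Finset.coe_Icc, Set.ncard_coe_finset, PNat.card_Icc, PNat.add_coe, PNat.one_coe,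
    Nat.add_sub_add_right]

theorem cond4_blockTableau (B : ι → Block) : (blockTableau B).Cond4 := by
  rintro I hI m n hm ⟨b, hb, rfl⟩ hmreg hnreg
  obtain rfl := eq_Icc_of_isLeast_of_isGreatest hI hm hb
  have hmb : (m : ℕ) + 1 ≤ b := hm.1.2
  have hmn : m ≤ b + 1 := (PNat.add_one_le_iff.mp hm.1.2).le.trans (PNat.lt_add_right b 1).le
  have hmem {k : ℕ+} (hmk : m < k) (hkn : k < b + 1) : k ∈ Set.Icc (m + 1) b :=
    ⟨PNat.add_one_le_iff.mpr hmk, PNat.lt_add_one_iff.mp hkn⟩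
  have heven (h : Odd (Set.Icc (m + 1) b).ncard) : Even (((b + 1 : ℕ+) : ℤ) - m) := by
    rw [ncard_Icc_add_one, Nat.odd_iff] at h
    rw [Int.even_iff]
    push_cast
    omega
  have hdiff {D : Set (ZMod 8)} (h : Odd (Set.Icc (m + 1) b).ncard) :=
    diffMem_blockTableau hmreg hnreg hmn (heven h) (D := D)
  have hsingle {r : ℕ} (hr : r ≤ 2) (h : (Set.Icc (m + 1) b).ncard = 1)
      (hcol : ∀ k : Set.Icc (m + 1) b, blockTableau B k = (r, ⊤)) :
      ∃ p ≤ r, ∑ i with m < (B i).level ∧ (B i).level < b + 1, (B i).sig m =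
        (r : ZMod 8) - 2 * p := by
    obtain rfl : b = m + 1 := PNat.coe_injective (by
      rw [ncard_Icc_add_one] at h; rw [PNat.add_coe, PNat.one_coe]; omega)
    exact exists_sum_sig_between_eq hr (hcol ⟨_, hm.1⟩)
  refine ⟨?_, ?_, ?_, ?_⟩
  · rintro ⟨hodd, hr⟩
    exact hdiff hodd (sum_sig_between_of_r_eq_zero fun k hmk hkn => hr ⟨k, hmem hmk hkn⟩)
  · rintro ⟨hone, hcol⟩
    obtain ⟨p, hp, hsum⟩ := hsingle one_le_two hone hcol
    refine hdiff (hone ▸ odd_one) (hsum ▸ ?_)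
    interval_cases p <;> decide
  · rintro ⟨hone, hcol⟩
    obtain ⟨p, hp, hsum⟩ := hsingle le_rfl hone hcol
    refine hdiff (hone ▸ odd_one) (hsum ▸ ?_)
    interval_cases p <;> decide
  · rintro ⟨hodd, hreg⟩
    exact hdiff hodd (sum_sig_between_of_isRegular fun k hmk hkn => hreg ⟨k, hmem hmk hkn⟩)

end Necessity

/-! ### Sufficiency of the conditions -/

theorem exists_odd_kinds (r p : ℕ) (hp : p ≤ r + 1) (w : ZMod 8) (hw : w = 0 ∨ w = 4) :
    ∃ (ι : Type) (_ : Fintype ι) (κ : ι → Kind), Nonempty ι ∧ (∀ i, (κ i).IsOdd) ∧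
      ∑ i, (κ i).rank = r + 1 ∧ ∑ i, (κ i).sigOddGap = ((r + 1 : ℕ) : ZMod 8) - 2 * p ∧
      ∑ i, (κ i).sigEvenGap = ((r + 1 : ℕ) : ZMod 8) - 2 * p + w := by
  induction r generalizing p with
  | zero =>
    obtain ⟨j, hodd, heven⟩ : ∃ j : ℤ, Kind.sigOddGap (.odd j) = 1 - 2 * p ∧
        Kind.sigEvenGap (.odd j) = 1 - 2 * p + w := by
      interval_cases p <;> rcases hw with rfl | rfl
      · exact ⟨0, by decide, by decide⟩
      · exact ⟨2, by decide, by decide⟩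
      · exact ⟨3, by decide, by decide⟩
      · exact ⟨1, by decide, by decide⟩
    exact ⟨Unit, inferInstance, fun _ => .odd j, inferInstance, fun _ => trivial, by simp,
      by simpa using hodd, by simpa using heven⟩
  | succ r ih =>
    obtain ⟨j, q, hq, hodd, heven⟩ : ∃ (j : ℤ) (q : ℕ), q ≤ r + 1 ∧
        Kind.sigOddGap (.odd j) = 1 - 2 * (p - q) ∧
        Kind.sigEvenGap (.odd j) = 1 - 2 * (p - q) := by
      rcases hp.lt_or_eq with hlt | rfl
      · refine ⟨0, p, by omega, ?_, ?_⟩ <;> rw [sub_self] <;> decide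
      · refine ⟨3, r + 1, le_rfl, ?_, ?_⟩ <;> push_cast <;> rw [add_sub_cancel_left] <;> decide
    obtain ⟨ι, _, κ, -, hκ, hrank, hsumOdd, hsumEven⟩ := ih q hq
    refine ⟨Option ι, inferInstance, fun o => o.elim (.odd j) κ, inferInstance,
      Option.forall.mpr ⟨trivial, hκ⟩, ?_, ?_, ?_⟩
    · rw [Fintype.sum_option, add_comm]; exact congrArg (· + 1) hrank
    · simp only [Fintype.sum_option, Option.elim, hsumOdd, hodd]; push_cast; ring
    · simp only [Fintype.sum_option, Option.elim, hsumEven, heven]; push_cast; ring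

theorem exists_even_kinds (a : ℕ) (u : ZMod 8) (hu : u = 0 ∨ u = 4) (h0 : a = 0 → u = 0) :
    ∃ (ι : Type) (_ : Fintype ι) (κ : ι → Kind), (∀ i, ¬ (κ i).IsOdd) ∧
      ∑ i, (κ i).rank = a + a ∧ ∑ i, (κ i).sigOddGap = u ∧ ∑ i, (κ i).sigEvenGap = 0 := by
  have hzero : Kind.sigOddGap (.even 0 0) = 0 := by simp [Kind.sigOddGap]
  cases a with
  | zero =>
    exact ⟨Empty, inferInstance, Empty.elim, fun i => i.elim, by simp, by simp [h0], by simp⟩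
  | succ a =>
    obtain ⟨c, hc⟩ : ∃ c : ℤ, Kind.sigOddGap (.even c c) = u := by
      rcases hu with rfl | rfl
      · exact ⟨0, hzero⟩
      · exact ⟨1, by simp [Kind.sigOddGap]⟩
    refine ⟨Option (Fin a), inferInstance, fun o => o.elim (.even c c) fun _ => .even 0 0,
      Option.forall.mpr ⟨id, fun _ => id⟩, ?_, ?_, ?_⟩
    · simp only [Fintype.sum_option, Option.elim, Finset.sum_const, Finset.card_univ,
        Fintype.card_fin, smul_eq_mul, Kind.rank]
      omega
    · simp [Fintype.sum_option, hc, hzero]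
    · simp [Fintype.sum_option, Kind.sigEvenGap]

theorem four_mul_natCast_eq_zero {n : ℕ} (h : Even n) : 4 * (n : ZMod 8) = 0 := by
  obtain ⟨a, rfl⟩ := h
  have h8 : (8 : ZMod 8) = 0 := by decide
  push_cast
  linear_combination (a : ZMod 8) * h8

namespace FullTableau

variable {T : FullTableau} {m n : ℕ+} {u v x : ZMod 8}

theorem one_le_r_of_not_isRegular (h : ¬ T.IsRegular m) : 1 ≤ T.r m :=
  Nat.one_le_iff_ne_zero.mpr fun h0 => h (.inl h0)

theorem s_eq_top_of_not_isRegular (h : ¬ T.IsRegular m) : T.s m = ⊤ :=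
  not_not.mp fun hs => h (.inr hs)

theorem tailRank_eq_add (hT : T.IsFinite) (k : ℕ+) :
    T.tailRank k = T.r k + T.tailRank (k + 1) := by
  have hfin : (Set.Ici (k + 1) ∩ Function.support fun j => T.r j).Finite := 
    (hT.subset (Function.support_comp_subset (g := Prod.fst) rfl T)).inter_of_right _
  have hset : (Set.Ici k : Set ℕ+) = insert k (Set.Ici (k + 1)) := by
    ext j
    rw [Set.mem_insert_iff, Set.mem_Ici, Set.mem_Ici, PNat.add_one_le_iff, le_iff_eq_or_lt,
      eq_comm]
  have hk : k ∉ Set.Ici (k + 1) := fun hk => (PNat.add_one_le_iff.mp hk).false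
  change ∑ᶠ j ∈ Set.Ici k, T.r j = T.r k + ∑ᶠ j ∈ Set.Ici (k + 1), T.r j
  rw [hset, finsum_mem_insert' _ hk hfin]

/-- The formal signature, with `∞` replaced by `0`. -/
def sVal (T : FullTableau) (m : ℕ+) : ZMod 8 := (T.s m).untopD 0

theorem sVal_eq_of_s_eq (h : T.s m = x) : T.sVal m = x := by rw [sVal, h, WithTop.untopD_coe]

theorem sVal_sub_sVal_mem {D : Set (ZMod 8)} (h : DiffMem (T.s m) (T.s n) D) :
    T.sVal m - T.sVal n ∈ D := by
  obtain ⟨x, y, hx, hy, hD⟩ := h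
  rwa [sVal_eq_of_s_eq hx, sVal_eq_of_s_eq hy]

theorem Cond2.s_eq_sVal (h : T.Cond2) (hm : T.IsRegular m) : T.s m = T.sVal m := by
  obtain ⟨x, hx, -⟩ := h m hm
  rw [sVal_eq_of_s_eq hx, hx]

theorem Cond2.four_mul_sVal (h : T.Cond2) (hm : T.IsRegular m) :
    4 * T.sVal m = 4 * (T.tailRank (m + 1) : ZMod 8) := by
  obtain ⟨x, hx, hcongr⟩ := (congrMod_iff (c := 4) rfl _ _).mp (h m hm)
  rw [sVal_eq_of_s_eq hx]
  exact hcongr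

theorem Cond2.four_mul_sVal_eq_add (h : T.Cond2) (hT : T.IsFinite) (hm : T.IsRegular m) :
    4 * T.sVal m = 4 * (T.r (m + 1) + T.r (m + 2) + T.tailRank (m + 2 + 1) : ZMod 8) := by
  have htail : T.tailRank (m + 1) = T.r (m + 1) + (T.r (m + 2) + T.tailRank (m + 2 + 1)) := by
    rw [tailRank_eq_add hT (m + 1), tailRank_eq_add hT (m + 1 + 1)]; rfl
  rw [h.four_mul_sVal hm, htail]
  push_cast
  ring

theorem Cond3.two_mul_sVal_eq (h : T.Cond3) (h2 : T.Cond2) (hm : T.IsRegular m)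
    (hm' : T.IsRegular (m + 1)) : 2 * T.sVal m = 2 * T.sVal (m + 1) := by
  obtain ⟨x, hx, hcongr⟩ := (congrMod_iff (c := 2) rfl _ _).mp (h m hm hm')
  rw [h2.s_eq_sVal hm, h2.s_eq_sVal hm', ← WithTop.coe_add, WithTop.coe_inj] at hx
  have hsum : 2 * (T.sVal m + T.sVal (m + 1)) = 2 * (2 * (T.tailRank (m + 1 + 1) : ZMod 8)) := by
    rw [hx]; exact_mod_cast hcongr
  linear_combination hsum - h2.four_mul_sVal hm'

theorem Cond4.sVal_sub_sVal_add_two (h : T.Cond4) (hm : T.IsRegular m)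
    (hm' : T.IsRegular (m + 2)) :
    (T.r (m + 1) = 0 → T.sVal m - T.sVal (m + 2) ∈ ({0} : Set (ZMod 8))) ∧
    (T (m + 1) = (1, ⊤) → T.sVal m - T.sVal (m + 2) ∈ ({1, -1} : Set (ZMod 8))) ∧
    (T (m + 1) = (2, ⊤) → T.sVal m - T.sVal (m + 2) ∈ ({0, 2, -2} : Set (ZMod 8))) ∧
    (T.IsRegular (m + 1) → T.sVal m - T.sVal (m + 2) ∈ ({0, 4} : Set (ZMod 8))) := by
  have hcard : ({m + 1} : Set ℕ+).ncard = 1 := Set.ncard_singleton _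
  obtain ⟨h0, h1, h2, h3⟩ := h {m + 1} Set.ordConnected_singleton m (m + 2) isLeast_singleton
    ⟨m + 1, isGreatest_singleton, rfl⟩ hm hm'
  exact ⟨fun hr => sVal_sub_sVal_mem (h0 ⟨hcard ▸ odd_one, by rintro ⟨_, rfl⟩; exact hr⟩),
    fun hcol => sVal_sub_sVal_mem (h1 ⟨hcard, by rintro ⟨_, rfl⟩; exact hcol⟩),
    fun hcol => sVal_sub_sVal_mem (h2 ⟨hcard, by rintro ⟨_, rfl⟩; exact hcol⟩),
    fun hreg => sVal_sub_sVal_mem (h3 ⟨hcard ▸ odd_one, by rintro ⟨_, rfl⟩; exact hreg⟩)⟩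

/-- `x` is a possible contribution to `σ_{m-1}` of a homogeneous pairing over `ℤ/2^m` of rank
`r(m)`, which splits off an odd block if and only if `m` is not regular. -/
def IsIncrement (T : FullTableau) (m : ℕ+) (x : ZMod 8) : Prop :=
  (T.IsRegular m ∧ (x = 0 ∨ x = 4) ∧ (T.r m = 0 → x = 0)) ∨
    (¬ T.IsRegular m ∧ ∃ p ≤ T.r m, x = T.r m - 2 * p)

theorem isIncrement_zero (h : T.IsRegular m) : T.IsIncrement m 0 :=
  .inl ⟨h, .inl rfl, fun _ => rfl⟩

theorem exists_isIncrement (T : FullTableau) (m : ℕ+) : ∃ x, T.IsIncrement m x := by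
  by_cases h : T.IsRegular m
  · exact ⟨0, isIncrement_zero h⟩
  · exact ⟨T.r m, .inr ⟨h, 0, Nat.zero_le _, by simp⟩⟩

theorem IsIncrement.four_mul (hx : T.IsIncrement m x) (h1 : T.Cond1) :
    4 * x = 4 * (T.r m : ZMod 8) := by
  rcases hx with ⟨hm, hx, -⟩ | ⟨-, p, -, rfl⟩
  · rw [four_mul_natCast_eq_zero (h1 m hm)]
    rcases hx with rfl | rfl <;> decide
  · have h8 : (8 : ZMod 8) = 0 := by decide
    linear_combination -(p : ZMod 8) * h8

theorem exists_sVal_sub_sVal_add_two_eq (h4 : T.Cond4) (hm : T.IsRegular m)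
    (hm' : T.IsRegular (m + 2)) (hreg : ¬ T.IsRegular (m + 1)) (hr : T.r (m + 1) ≤ 2) :
    ∃ p ≤ T.r (m + 1), T.sVal m - T.sVal (m + 2) = T.r (m + 1) - 2 * p := by
  obtain ⟨-, type1, type2, -⟩ := h4.sVal_sub_sVal_add_two hm hm'
  have htop := s_eq_top_of_not_isRegular hreg
  have hr1 := one_le_r_of_not_isRegular hreg
  obtain h | h : T.r (m + 1) = 1 ∨ T.r (m + 1) = 2 := by omega
  · rw [h]
    rcases type1 (Prod.ext h htop) with hd | hd <;> rw [hd]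
    · exact ⟨0, by omega, by decide⟩
    · exact ⟨1, by omega, by decide⟩
  · rw [h]
    rcases type2 (Prod.ext h htop) with hd | hd | hd <;> rw [hd]
    · exact ⟨1, by omega, by decide⟩
    · exact ⟨0, by omega, by decide⟩
    · exact ⟨2, by omega, by decide⟩

theorem isIncrement_sVal_sub_sVal_add_two (hT : T.IsFinite) (h1 : T.Cond1) (h2 : T.Cond2)
    (h4 : T.Cond4) (hm : T.IsRegular m) (hm' : T.IsRegular (m + 2)) :
    T.IsIncrement (m + 1) (T.sVal m - T.sVal (m + 2)) := by
  by_cases hreg : T.IsRegular (m + 1)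
  · obtain ⟨type0, -, -, type3⟩ := h4.sVal_sub_sVal_add_two hm hm'
    exact .inl ⟨hreg, type3 hreg, type0⟩
  refine .inr ⟨hreg, ?_⟩
  rcases le_or_gt (T.r (m + 1)) 2 with hr | hr
  · exact exists_sVal_sub_sVal_add_two_eq h4 hm hm' hreg hr
  -- In rank at least 3, the increments take every value of the right parity.
  · have hpar : 4 * (T.sVal m - T.sVal (m + 2)) = 4 * (T.r (m + 1) : ZMod 8) := by
      linear_combination h2.four_mul_sVal_eq_add hT hm - h2.four_mul_sVal hm' +
        four_mul_natCast_eq_zero (h1 _ hm')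
    have hexists : ∀ x y : ZMod 8, 4 * x = 4 * y → ∃ p < 4, x = y - 2 * (p : ℕ) := by decide
    obtain ⟨p, hp, hsub⟩ := hexists _ _ hpar
    exact ⟨p, by omega, hsub⟩

/-- `u` and `v` are possible simultaneous contributions to `σ_{m-1}` and `σ_{m-2}` of a homogeneous
pairing over `ℤ/2^m` as in `IsIncrement`. -/
def IsIncrementPair (T : FullTableau) (m : ℕ+) (u v : ZMod 8) : Prop :=
  T.IsIncrement m u ∧ (T.IsRegular m → v = 0) ∧ (¬ T.IsRegular m → v = u ∨ v = u + 4)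

theorem IsIncrementPair.exists_kinds (h : T.IsIncrementPair m u v) (h1 : T.Cond1) :
    ∃ (ι : Type) (_ : Fintype ι) (κ : ι → Kind), ((∃ i, (κ i).IsOdd) ↔ ¬ T.IsRegular m) ∧
      ∑ i, (κ i).rank = T.r m ∧ ∑ i, (κ i).sigOddGap = u ∧ ∑ i, (κ i).sigEvenGap = v := by
  obtain ⟨⟨hm, hu, hu0⟩ | ⟨hm, p, hp, hu⟩, hvreg, hvirr⟩ := h
  · obtain ⟨a, ha⟩ := h1 m hm
    obtain ⟨ι, _, κ, hκ, hrank, hsumOdd, hsumEven⟩ :=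
      exists_even_kinds a u hu fun h0 => hu0 (by omega)
    exact ⟨ι, inferInstance, κ, ⟨fun ⟨i, hi⟩ => (hκ i hi).elim, fun h => absurd hm h⟩,
      hrank.trans ha.symm, hsumOdd, hsumEven.trans (hvreg hm).symm⟩
  · obtain ⟨r, hr⟩ := Nat.exists_eq_add_of_le' (one_le_r_of_not_isRegular hm)
    obtain ⟨w, hw, hvw⟩ : ∃ w, (w = 0 ∨ w = 4) ∧ v = u + w := by
      rcases hvirr hm with h | h
      · exact ⟨0, .inl rfl, by rw [h, add_zero]⟩
      · exact ⟨4, .inr rfl, h⟩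
    obtain ⟨ι, _, κ, ⟨i⟩, hκ, hrank, hsumOdd, hsumEven⟩ := exists_odd_kinds r p (hr ▸ hp) w hw
    rw [hr] at hu
    exact ⟨ι, inferInstance, κ, ⟨fun _ => hm, fun _ => ⟨i, hκ i⟩⟩, hrank.trans hr.symm,
      hsumOdd.trans hu.symm, by rw [hsumEven, hvw, hu]⟩

theorem exists_isIncrement_sVal_eq_add {k : ℕ+} {q : ZMod 8}
    (h : ∀ m, m + 1 = k → T.IsRegular m → T.IsIncrement k (T.sVal m - q)) :
    ∃ u, T.IsIncrement k u ∧ ∀ m, m + 1 = k → T.IsRegular m → T.sVal m = q + u := by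
  by_cases hex : ∃ m, m + 1 = k ∧ T.IsRegular m
  · obtain ⟨m, hm, hr⟩ := hex
    refine ⟨_, h m hm hr, fun m' hm' _ => ?_⟩
    obtain rfl : m' = m := add_right_cancel (hm'.trans hm.symm)
    ring
  · obtain ⟨x, hx⟩ := exists_isIncrement T k
    exact ⟨x, hx, fun m hm hr => (hex ⟨m, hm, hr⟩).elim⟩

theorem exists_isIncrement_sub_of_isRegular (h2 : T.Cond2) (h3 : T.Cond3) {q₁ q₂ : ZMod 8}
    (hm : T.IsRegular m) (hm' : T.IsRegular (m + 1)) (hu : T.sVal (m + 1) = q₂ + u)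
    (hq : 2 * q₁ = 2 * q₂) :
    ∃ v, (v = u ∨ v = u + 4) ∧ T.IsIncrement (m + 1) (T.sVal m - (q₁ + v)) := by
  have hdouble : 2 * (T.sVal m - (q₁ + u)) = 0 := by
    linear_combination h3.two_mul_sVal_eq h2 hm hm' + 2 * hu - hq
  have hzero_or_four : ∀ x : ZMod 8, 2 * x = 0 → x = 0 ∨ x = 4 := by decide
  rcases hzero_or_four _ hdouble with h | h
  · exact ⟨u, .inl rfl, h ▸ isIncrement_zero hm'⟩
  · refine ⟨u + 4, .inr rfl, ?_⟩
    rw [← add_assoc, ← sub_sub, h, sub_self]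
    exact isIncrement_zero hm'

theorem exists_isIncrement_sub_of_not_isRegular (hT : T.IsFinite) (h1 : T.Cond1) (h2 : T.Cond2)
    {q : ZMod 8} (hm : T.IsRegular m) (hm' : ¬ T.IsRegular (m + 1))
    (hu : T.IsIncrement (m + 2) u) (hq : 4 * q = 4 * (T.tailRank (m + 2 + 1) : ZMod 8)) :
    ∃ v, (v = u ∨ v = u + 4) ∧ T.IsIncrement (m + 1) (T.sVal m - (q + v)) := by
  have hpar : 4 * (T.sVal m - (q + u)) = 4 * (T.r (m + 1) : ZMod 8) := by
    linear_combination h2.four_mul_sVal_eq_add hT hm - hq - hu.four_mul h1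
  have hexists : ∀ x y : ZMod 8, 4 * x = 4 * y →
      ∃ p < 2, x = y - 2 * (p : ℕ) ∨ x - 4 = y - 2 * (p : ℕ) := by decide
  obtain ⟨p, hp, hsub | hsub⟩ := hexists _ _ hpar
  all_goals have hpr : p ≤ T.r (m + 1) := by have := one_le_r_of_not_isRegular hm'; omega
  · exact ⟨u, .inl rfl, .inr ⟨hm', p, hpr, hsub⟩⟩
  · exact ⟨u + 4, .inr rfl, .inr ⟨hm', p, hpr, by rw [← hsub]; ring⟩⟩

theorem exists_isIncrementPair (hT : T.IsFinite) (h1 : T.Cond1) (h2 : T.Cond2) (h3 : T.Cond3)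
    (h4 : T.Cond4) {k : ℕ+} {q₁ q₂ : ZMod 8} (hk : T.IsRegular k → T.sVal k = q₁)
    (hpred : ∀ m, m + 1 = k → T.IsRegular m → T.IsIncrement k (T.sVal m - q₂))
    (hcongr : 2 * q₁ = 2 * q₂) (hpar : 4 * q₁ = 4 * (T.tailRank (k + 1) : ZMod 8)) :
    ∃ u v, T.IsIncrementPair k u v ∧ (∀ m, m + 1 = k → T.IsRegular m → T.sVal m = q₂ + u) ∧
      ∀ m, m + 2 = k → T.IsRegular m → T.IsIncrement (m + 1) (T.sVal m - (q₁ + v)) := by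
  obtain ⟨u, hinc, hu⟩ := exists_isIncrement_sVal_eq_add hpred
  by_cases hreg : T.IsRegular k
  · refine ⟨u, 0, ⟨hinc, fun _ => rfl, fun h => absurd hreg h⟩, hu, ?_⟩
    rintro m rfl hm
    rw [add_zero, ← hk hreg]
    exact isIncrement_sVal_sub_sVal_add_two hT h1 h2 h4 hm hreg
  obtain ⟨v, hv, hnext⟩ : ∃ v, (v = u ∨ v = u + 4) ∧
      ∀ m, m + 2 = k → T.IsRegular m → T.IsIncrement (m + 1) (T.sVal m - (q₁ + v)) := by
    by_cases hex : ∃ m, m + 2 = k ∧ T.IsRegular m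
    · obtain ⟨m, rfl, hm⟩ := hex
      obtain ⟨v, hv, hinc'⟩ :
          ∃ v, (v = u ∨ v = u + 4) ∧ T.IsIncrement (m + 1) (T.sVal m - (q₁ + v)) := by
        by_cases hm' : T.IsRegular (m + 1)
        · exact exists_isIncrement_sub_of_isRegular h2 h3 hm hm' (hu (m + 1) rfl hm') hcongr
        · exact exists_isIncrement_sub_of_not_isRegular hT h1 h2 hm hm' hinc hpar
      refine ⟨v, hv, fun m' hm' _ => ?_⟩
      obtain rfl : m' = m := add_right_cancel hm'
      exact hinc'
    · exact ⟨u, .inl rfl, fun m hm hr => (hex ⟨m, hm, hr⟩).elim⟩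
  exact ⟨u, v, ⟨hinc, fun h => absurd h hreg, fun _ => hv⟩, hu, hnext⟩

end FullTableau

section AddBlocks

variable {ι ι' : Type*}

/-- The family of blocks `B`, enlarged by blocks of the kinds `κ j` at level `k`. -/
def addBlocks (B : ι → Block) (k : ℕ+) (κ : ι' → Kind) : ι ⊕ ι' → Block :=
  Sum.elim B fun j => ⟨k, κ j⟩

variable (B : ι → Block) (k : ℕ+) (κ : ι' → Kind)

theorem exists_isOdd_addBlocks_iff {m : ℕ+} :
    (∃ i, (addBlocks B k κ i).level = m ∧ (addBlocks B k κ i).kind.IsOdd) ↔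
      (∃ i, (B i).level = m ∧ (B i).kind.IsOdd) ∨ k = m ∧ ∃ j, (κ j).IsOdd := by
  rw [Sum.exists, ← exists_and_left]
  rfl

variable [Fintype ι] [Fintype ι']

theorem familyRank_addBlocks (m : ℕ+) :
    familyRank (addBlocks B k κ) m = familyRank B m + if k = m then ∑ j, (κ j).rank else 0 := by
  rw [familyRank, Fintype.sum_sum_type]
  refine congrArg (familyRank B m + ·) ?_
  split_ifs with h
  · exact Finset.sum_congr rfl fun j _ => if_pos h
  · exact Finset.sum_eq_zero fun j _ => if_neg h

theorem sum_sig_addBlocks (m : ℤ) :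
    ∑ i, (addBlocks B k κ i).sig m = ∑ i, (B i).sig m + ∑ j, (Block.mk k (κ j)).sig m :=
  Fintype.sum_sum_type _

theorem sum_sig_addBlocks_of_le {m : ℤ} (h : k ≤ m) :
    ∑ i, (addBlocks B k κ i).sig m = ∑ i, (B i).sig m := by
  have hzero : ∑ j, (Block.mk k (κ j)).sig m = 0 :=
    Finset.sum_eq_zero fun j _ => Block.sig_of_le (b := ⟨k, κ j⟩) h
  rw [sum_sig_addBlocks, hzero, add_zero]

theorem sum_sig_addBlocks_sub_one :
    ∑ i, (addBlocks B k κ i).sig (k - 1) =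
      ∑ i, (B i).sig (k - 1) + ∑ j, (κ j).sigOddGap := by
  rw [sum_sig_addBlocks]
  congr! 2 with j
  exact Block.sig_of_odd (sub_one_lt _) (by rw [sub_sub_cancel]; exact odd_one)

variable {B}

theorem sum_sig_addBlocks_sub_two (hB : ∀ i, k < (B i).level) :
    ∑ i, (addBlocks B k κ i).sig (k - 2) = ∑ i, (B i).sig k + ∑ j, (κ j).sigEvenGap := by
  rw [sum_sig_addBlocks]
  congr! 2 with i _ j
  · have hi : (k : ℤ) < (B i).level := by exact_mod_cast hB i
    rw [← sub_eq_zero, Block.sig_sub_sig (by omega) (by rw [sub_sub_cancel]; exact even_two)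
      fun h => absurd h hi.ne', if_neg fun h => h.2.not_gt hi]
  · exact Block.sig_of_even (sub_lt_self _ two_pos) (by rw [sub_sub_cancel]; exact even_two)

end AddBlocks

/-- The blocks `B i` have levels greater than `k` and realize the ranks, the irregular levels and
the finite signatures of the tableau `T` as far as these depend only on such blocks. The field
`isIncrement` says that blocks of level `k` can be chosen so as to realize `T` at `k - 1` too. -/
structure Realizes (T : FullTableau) (k : ℕ) {ι : Type*} [Fintype ι] (B : ι → Block) : Prop where
  lt_level : ∀ i, k < (B i).level
  rank : ∀ m : ℕ+, k < m → familyRank B m = T.r m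
  odd : ∀ m : ℕ+, k < m → ((∃ i, (B i).level = m ∧ (B i).kind.IsOdd) ↔ ¬ T.IsRegular m)
  sig : ∀ m : ℕ+, k ≤ m → T.IsRegular m → T.sVal m = ∑ i, (B i).sig m
  isIncrement : ∀ m : ℕ+, m + 1 = k → T.IsRegular m →
    T.IsIncrement (m + 1) (T.sVal m - ∑ i, (B i).sig m)

namespace Realizes

variable {T : FullTableau}

theorem of_forall_le {N : ℕ} (hN : ∀ m : ℕ+, N ≤ m → T m = (0, 0)) :
    Realizes T (N + 1) (Empty.elim : Empty → Block) := by
  have hr (m : ℕ+) (h : N ≤ m) : T.r m = 0 := by rw [FullTableau.r, hN m h]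
  have hreg (m : ℕ+) (h : N ≤ m) : T.IsRegular m := .inl (hr m h)
  have hs (m : ℕ+) (h : N ≤ m) : T.sVal m = 0 := FullTableau.sVal_eq_of_s_eq (by
    rw [FullTableau.s, hN m h]; rfl)
  refine
    { lt_level := fun i => i.elim
      rank := fun m hm => by rw [hr m (by omega)]; rfl
      odd := fun m hm => ⟨fun ⟨i, _⟩ => i.elim, fun h => absurd (hreg m (by omega)) h⟩
      sig := fun m hm _ => by rw [hs m (by omega)]; rfl
      isIncrement := fun m hm _ => ?_ }
  rw [hs m (by omega), Finset.univ_eq_empty, Finset.sum_empty, sub_zero]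
  exact FullTableau.isIncrement_zero (hreg _ (by rw [PNat.add_coe]; omega))

theorem eq_blockTableau {ι : Type*} [Fintype ι] {B : ι → Block} (hB : Realizes T 0 B)
    (h2 : T.Cond2) : T = blockTableau B := by
  funext m
  refine Prod.ext (hB.rank m m.pos).symm (?_ : T.s m = familySig B m)
  by_cases hm : T.IsRegular m
  · rw [familySig, if_neg fun h => (hB.odd m m.pos).mp h hm, h2.s_eq_sVal hm,
      hB.sig m (Nat.zero_le _) hm]
  · rw [familySig, if_pos ((hB.odd m m.pos).mpr hm), FullTableau.s_eq_top_of_not_isRegular hm]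

section Descent

variable {ι ι' : Type*} [Fintype ι] [Fintype ι'] {B : ι → Block} {k : ℕ+}

theorem tailRank_eq (hB : Realizes T k B) : T.tailRank (k + 1) = ∑ i, (B i).kind.rank := by
  have htail : T.tailRank (k + 1) = (blockTableau B).tailRank (k + 1) := by
    refine finsum_congr fun j => finsum_congr fun hj => (hB.rank j ?_).symm
    exact PNat.coe_lt_coe _ _ |>.mpr (PNat.add_one_le_iff.mp hj)
  rw [htail, tailRank_blockTableau]
  exact Finset.sum_congr rfl fun i _ =>
    if_pos (PNat.add_one_le_iff.mpr (PNat.coe_lt_coe _ _ |>.mp (hB.lt_level i)))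

theorem four_mul_sum_sig (hB : Realizes T k B) :
    4 * ∑ i, (B i).sig k = 4 * (T.tailRank (k + 1) : ZMod 8) := by
  rw [hB.tailRank_eq, Nat.cast_sum, Finset.mul_sum, Finset.mul_sum]
  refine Finset.sum_congr rfl fun i _ => ?_
  rw [Block.four_mul_sig, if_pos (by exact_mod_cast hB.lt_level i)]

theorem two_mul_sum_sig (hB : Realizes T k B) :
    2 * ∑ i, (B i).sig k = 2 * ∑ i, (B i).sig (k - 1) := by
  rw [Finset.mul_sum, Finset.mul_sum]
  refine Finset.sum_congr rfl fun i _ => ?_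
  have hi : (k : ℤ) < (B i).level := by exact_mod_cast hB.lt_level i
  rw [Block.two_mul_sig hi, Block.two_mul_sig ((sub_one_lt _).trans hi)]

theorem addBlocks {j : ℕ} (hB : Realizes T k B) (hk : k = j + 1) {κ : ι' → Kind}
    (hodd : (∃ i, (κ i).IsOdd) ↔ ¬ T.IsRegular k) (hrank : ∑ i, (κ i).rank = T.r k)
    (hsub_one : ∀ m, m + 1 = k → T.IsRegular m →
      T.sVal m = ∑ i, (B i).sig (k - 1) + ∑ i, (κ i).sigOddGap)
    (hsub_two : ∀ m, m + 2 = k → T.IsRegular m →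
      T.IsIncrement (m + 1) (T.sVal m - (∑ i, (B i).sig k + ∑ i, (κ i).sigEvenGap))) :
    Realizes T j (Enlacement.addBlocks B k κ) where
  lt_level
    | .inl i => by have := hB.lt_level i; change j < ((B i).level : ℕ); omega
    | .inr i => by change j < (k : ℕ); omega
  rank m hm := by
    rw [familyRank_addBlocks]
    rcases eq_or_ne k m with rfl | hne
    · have h0 : familyRank B k = 0 := Finset.sum_eq_zero fun i _ =>
        if_neg fun h => (hB.lt_level i).ne' (congrArg _ h)
      rw [h0, if_pos rfl, hrank, zero_add]
    · have : (k : ℕ) ≠ m := PNat.coe_injective.ne hne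
      rw [if_neg hne, hB.rank m (by omega), add_zero]
  odd m hm := by
    rw [exists_isOdd_addBlocks_iff]
    rcases eq_or_ne k m with rfl | hne
    · have hnone : ¬ ∃ i, (B i).level = k ∧ (B i).kind.IsOdd :=
        fun ⟨i, hi, _⟩ => (hB.lt_level i).ne' (congrArg _ hi)
      rw [hodd, or_iff_right hnone, and_iff_right rfl]
    · have : (k : ℕ) ≠ m := PNat.coe_injective.ne hne
      rw [or_iff_left fun h => hne h.1, hB.odd m (by omega)]
  sig m hm hr := by
    rcases hm.eq_or_lt with heq | hlt
    · rw [hsub_one m (PNat.coe_injective (by rw [PNat.add_coe, PNat.one_coe]; omega)) hr,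
        show (m : ℤ) = k - 1 by omega, sum_sig_addBlocks_sub_one]
    · rw [sum_sig_addBlocks_of_le B k κ (by omega), hB.sig m (by omega) hr]
  isIncrement m hm hr := by
    have hlevel (i : ι) : k < (B i).level := PNat.coe_lt_coe _ _ |>.mp (hB.lt_level i)
    rw [show (m : ℤ) = k - 2 by omega, sum_sig_addBlocks_sub_two k κ hlevel]
    exact hsub_two m (PNat.coe_injective (by rw [PNat.add_coe, PNat.val_ofNat]; omega)) hr

end Descent

theorem exists_pred (hT : T.IsFinite) (h1 : T.Cond1) (h2 : T.Cond2) (h3 : T.Cond3)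
    (h4 : T.Cond4) {j : ℕ} {ι : Type} [Fintype ι] {B : ι → Block} (hB : Realizes T (j + 1) B) :
    ∃ (ι' : Type) (_ : Fintype ι') (B' : ι' → Block), Realizes T j B' := by
  obtain ⟨k, hk⟩ : ∃ k : ℕ+, (k : ℕ) = j + 1 := ⟨j.succPNat, rfl⟩
  rw [← hk] at hB
  have hpred (m : ℕ+) (hm : m + 1 = k) (hr : T.IsRegular m) :
      T.IsIncrement k (T.sVal m - ∑ i, (B i).sig (k - 1)) := by
    subst hm
    simpa using hB.isIncrement m rfl hr
  obtain ⟨u, v, hpair, hu, hv⟩ := FullTableau.exists_isIncrementPair hT h1 h2 h3 h4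
    (hB.sig k le_rfl) hpred hB.two_mul_sum_sig hB.four_mul_sum_sig
  obtain ⟨ι', _, κ, hodd, hrank, rfl, rfl⟩ := hpair.exists_kinds h1
  exact ⟨ι ⊕ ι', inferInstance, _, hB.addBlocks hk hodd hrank hu hv⟩

end Realizes

theorem FullTableau.IsFinite.exists_forall_le_eq_zero {T : FullTableau} (hT : T.IsFinite) :
    ∃ N : ℕ, ∀ m : ℕ+, N ≤ m → T m = (0, 0) := by
  obtain ⟨M, hM⟩ := hT.bddAbove
  refine ⟨M + 1, fun m hm => ?_⟩
  by_contra h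
  exact (PNat.coe_le_coe _ _ |>.mpr (hM (Function.mem_support.mpr h))).not_gt hm

theorem exists_eq_blockTableau {T : FullTableau} (hT : T.IsFinite) (h1 : T.Cond1) (h2 : T.Cond2)
    (h3 : T.Cond3) (h4 : T.Cond4) :
    ∃ (ι : Type) (_ : Fintype ι) (B : ι → Block), T = blockTableau B := by
  obtain ⟨N, hN⟩ := hT.exists_forall_le_eq_zero
  have hdescent (k : ℕ) (hk : k ≤ N + 1) :
      ∃ (ι : Type) (_ : Fintype ι) (B : ι → Block), Realizes T k B := by
    induction hk using Nat.decreasingInduction with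
    | of_succ k _ ih =>
      obtain ⟨ι, _, B, hB⟩ := ih
      exact hB.exists_pred hT h1 h2 h3 h4
    | self => exact ⟨Empty, inferInstance, Empty.elim, .of_forall_le hN⟩
  obtain ⟨ι, _, B, hB⟩ := hdescent 0 (Nat.zero_le _)
  exact ⟨ι, inferInstance, B, hB.eq_blockTableau h2⟩

end

end Enlacement

open Enlacement in
theorem mainTheorem1 (T : Enlacement.FullTableau) (hT : T.IsFinite) :
    T.Admissible ↔ T.Cond1 ∧ T.Cond2 ∧ T.Cond3 ∧ T.Cond4 := by
  rw [admissible_iff_exists_blockTableau]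
  constructor
  · rintro ⟨ι, _, B, rfl⟩
    exact ⟨cond1_blockTableau B, cond2_blockTableau B, cond3_blockTableau B, cond4_blockTableau B⟩
  · rintro ⟨h1, h2, h3, h4⟩
    exact exists_eq_blockTableau hT h1 h2 h3 h4
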